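/- A plane partition in an $a\times b\times c$ box is a set of unit cubes of the box such that below, behind and to the left of each of its cubes there is another of its cubes or a wall. Let $N(a,b,c)$ be the number of plane partitions in an $a\times b\times c$ box, and let $N(a,b,c)_{-1}=\sum_\pi(-1)^{|\pi|}$, the sum running over these plane partitions and $|\pi|$ being the number of cubes of $\pi$ (that is, the $q$-enumeration at $q=-1$). In an $m\times b\times b$ box let $\tau(i,j,k)=(m+1-i,\,b+1-k,\,b+1-j)$. A plane partition $\pi$ in this box is transpose-complement (a TCPP) if for every cube $x$ exactly one of $x,\tau(x)$ belongs to $\pi$; let $N_6(m,b,b)$ be the number of TCPPs. A move from one TCPP to another replaces one cube $x$ by $\tau(x)$. The relative sign of two TCPPs is $+1$ if they differ by an even number of moves and $-1$ if they differ by an odd number of moves. Let $N_6(m,b,b)_{-1}$ be the sum over all TCPPs of their signs relative to a fixed TCPP; it is defined up to an overall sign, so only its absolute value matters. Then for all integers $a,b,c\ge 0$: \begin{align*} N(2a,2b,2c)_{-1} &= N(a,b,c)^2,\\ N(2a+1,2b,2c)_{-1} &= N(a,b,c)\,N(a+1,b,c),\\ N(2a+1,2b+1,2c)_{-1} &= N(a,b+1,c)\,N(a+1,b,c),\\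 |N_6(4a,2b,2b)_{-1}| &= N_6(2a,b,b)^2,\\ |N_6(4a+2,2b+1,2b+1)_{-1}| &= N_6(2a,b+1,b+1)\,N_6(2a+2,b,b),\\ |N_6(4a,2b+1,2b+1)_{-1}| &= N_6(2a,b,b)\,N_6(2a,b+1,b+1), \end{align*} the last three for every choice of the reference TCPP. -/

import Mathlib

/-- The unit cubes of an `a × b × c` box, with the componentwise order. -/
abbrev Cube (a b c : ℕ) : Type := Fin a × Fin b × Fin c

/-- A plane partition in an `a × b × c` box: a set of unit cubes such that below, behind and to the
left of each of its cubes there is another of its cubes or a wall. -/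
abbrev PlanePartition (a b c : ℕ) : Type :=
  {π : Finset (Cube a b c) // IsLowerSet (π : Set (Cube a b c))}

noncomputable instance (a b c : ℕ) : Fintype (PlanePartition a b c) :=
  Fintype.ofFinite _

/-- `N(a,b,c)`: the number of plane partitions in an `a × b × c` box. -/
noncomputable def numPP (a b c : ℕ) : ℕ := Fintype.card (PlanePartition a b c)

/-- `N(a,b,c)_q`: the `q`-enumeration, a plane partition with `k` cubes having weight `q ^ k`. -/
noncomputable def qEnumPP {R : Type*} [CommRing R] (q : R) (a b c : ℕ) : R :=
  ∑ π : PlanePartition a b c, q ^ π.1.card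

/-- The symmetry of the `m × b × b` box (central reflection followed by the exchange of the two
axes of equal length) that underlies transpose-complementation, acting on cubes. -/
def transposeCompl {m b : ℕ} (x : Cube m b b) : Cube m b b :=
  (x.1.rev, x.2.2.rev, x.2.1.rev)

/-- Transpose-complement plane partitions (TCPPs) in an `m × b × b` box: exactly one of `x` and
`transposeCompl x` is filled, for every cube `x`. -/
abbrev TCPP (m b : ℕ) : Type :=
  {π : PlanePartition m b b // ∀ x : Cube m b b, x ∈ π.1 ↔ transposeCompl x ∉ π.1}

noncomputable instance (m b : ℕ) : Fintype (TCPP m b) := Fintype.ofFinite _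

/-- `N₆(m,b,b)`: the number of TCPPs in an `m × b × b` box. -/
noncomputable def numTCPP (m b : ℕ) : ℕ := Fintype.card (TCPP m b)

/-- The graph of moves between TCPPs: two TCPPs are adjacent when one arises from the other by
replacing the filled half `{x}` of one orbit of cubes by the opposite half `{transposeCompl x}`. -/
def tcppMoveGraph (m b : ℕ) : SimpleGraph (TCPP m b) :=
  SimpleGraph.fromRel fun π π' =>
    ∃ x ∈ π.1.1, π'.1.1 = insert (transposeCompl x) (π.1.1.erase x)

open Classical in
/-- The relative sign of two TCPPs: `1` if they differ by an even number of moves and `-1` if they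
differ by an odd number of moves (and `0` if they differed by neither or by both). -/
noncomputable def tcppSign {m b : ℕ} (π₀ π : TCPP m b) : ℤ :=
  (if ∃ p : (tcppMoveGraph m b).Walk π₀ π, Even p.length then 1 else 0) -
    (if ∃ p : (tcppMoveGraph m b).Walk π₀ π, Odd p.length then 1 else 0)

/-- `N₆(m,b,b)_{-1}`: the signed enumeration of TCPPs, with signs taken relative to `π₀`. -/
noncomputable def signedTCPP {m b : ℕ} (π₀ : TCPP m b) : ℤ :=
  ∑ π : TCPP m b, tcppSign π₀ π

/-- In a box whose first side is even there is a TCPP: the lower half of the box. -/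
theorem nonempty_TCPP (a b : ℕ) : Nonempty (TCPP (2 * a) b) := by
  refine ⟨⟨⟨Finset.univ.filter fun x => (x.1 : ℕ) < a, ?_⟩, ?_⟩⟩
  · intro x y hyx hx
    have h : (y.1 : ℕ) ≤ x.1 := hyx.1
    simp only [Finset.coe_filter, Finset.mem_univ, true_and, Set.mem_ofPred_eq] at hx ⊢
    omega
  · intro x
    have h := x.1.2
    simp only [Finset.mem_filter, Finset.mem_univ, true_and, transposeCompl, Fin.val_rev]
    omega

/-! Each layer of a plane partition is bounded by a lattice path. After shifting layer `i` by `a - 1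
- i`, nesting of layers means that `a` particles, each staying or rising by one per step, never
collide. Expanding a determinant multilinearly in its rows, one time step at a time, enumerates such
families: a first collision makes two rows equal (`det_transfer`), so no sign-reversing involution
is needed. Weight `q ^ r` for a rise with `r` steps remaining records the number of cubes up to a
fixed factor.

At `q = -1` the steps alternate between `1 + S` and `1 - S`, with `S` the shift, and two of them
make `1 - S²`, which preserves the parity of the position. The determinant splits into an even and
an odd block, where `1 - S²` acts as `1 - S`; conjugation by alternating signs turns this into `1 +
S`, the operator of the plain count. If a factor `1 + S` is left over, column operations make the
matrix block triangular.

A TCPP is determined by its lower half. Its sign is the parity of the number of cubes there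
(`tcppSign_eq`), and the complementation condition is a wall below the paths (`isLowerHalf_iff`).
Relative to the wall, two steps at `q = 1` are conjugate, up to sign, to a second difference `Δ`
with reflecting boundary. At `q = -1` they form an operator `D` whose square induces `Δ` both on
sums of adjacent pairs and on the kernel of these sums, so the determinant factors into minors of
powers of `Δ`. An odd power leaves one `D`, which contributes a forward and a backward difference;
column operations turn these into the identity and `Δ`. -/

/-! ### Transfer determinants and noncolliding particles. -/

/-- The `n`-step transfer operator on functions of a position. The step after which `r` steps remain
either keeps the position `z`, with weight `α r z`, or raises it by one, with weight `β r z`. -/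
def transfer {R : Type*} [CommRing R] (α β : ℕ → ℕ → R) : ℕ → (ℕ → R) → ℕ → R
  | 0, w => w
  | n + 1, w => fun z => α n z * transfer α β n w z + β n z * transfer α β n w (z + 1)

/-- The positions at time `t` of `a` particles that start at `x`, where `s u` is the set of
particles that are raised at time `u`. -/
def trajectory {a n : ℕ} (x : Fin a → ℕ) (s : Fin n → Finset (Fin a)) (t : ℕ) (i : Fin a) : ℕ :=
  x i + (Finset.univ.filter fun u : Fin n => (u : ℕ) < t ∧ i ∈ s u).card

/-- The positions after the particles in `s` are raised. -/
def raise {a : ℕ} (x : Fin a → ℕ) (s : Finset (Fin a)) (i : Fin a) : ℕ :=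
  x i + if i ∈ s then 1 else 0

theorem trajectory_zero {a n : ℕ} (x : Fin a → ℕ) (s : Fin n → Finset (Fin a)) :
    trajectory x s 0 = x := by
  ext i; simp [trajectory]

theorem trajectory_cons {a n : ℕ} (x : Fin a → ℕ) (s₀ : Finset (Fin a))
    (s : Fin n → Finset (Fin a)) (t : ℕ) :
    trajectory x (Fin.cons s₀ s : Fin (n + 1) → Finset (Fin a)) (t + 1) =
      trajectory (raise x s₀) s t := by
  ext i
  simp only [trajectory, raise, add_assoc]
  congr 1
  rw [Finset.card_filter, Finset.card_filter, Fin.sum_univ_succ]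
  simp

theorem trajectory_succ {a n : ℕ} (x : Fin a → ℕ) (s : Fin n → Finset (Fin a)) (u : Fin n)
    (i : Fin a) :
    trajectory x s (u + 1) i = trajectory x s u i + if i ∈ s u then 1 else 0 := by
  simp only [trajectory, add_assoc]
  congr 1
  have h : (Finset.univ.filter fun v : Fin n => (v : ℕ) < u + 1 ∧ i ∈ s v) =
      (Finset.univ.filter fun v : Fin n => (v : ℕ) < u ∧ i ∈ s v) ∪
        (if i ∈ s u then {u} else ∅) := by
    ext v
    split_ifs with hu
    · simp only [Finset.mem_filter, Finset.mem_univ, true_and, Finset.mem_union,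
        Finset.mem_singleton, Nat.lt_succ_iff_lt_or_eq, ← Fin.ext_iff]
      constructor
      · rintro ⟨h | h, h'⟩ <;> tauto
      · rintro (h | rfl) <;> tauto
    · simp only [Finset.mem_filter, Finset.mem_univ, true_and, Finset.union_empty,
        Nat.lt_succ_iff_lt_or_eq, ← Fin.ext_iff]
      constructor
      · rintro ⟨h | rfl, h'⟩ <;> tauto
      · tauto
  rw [h, Finset.card_union_of_disjoint]
  · split_ifs <;> simp
  · split_ifs <;> simp

/-- The weight of a family of particle trajectories. -/
def trajectoryWeight {R : Type*} [CommRing R] (α β : ℕ → ℕ → R) {a n : ℕ} (x : Fin a → ℕ)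
    (s : Fin n → Finset (Fin a)) : R :=
  ∏ u : Fin n, ∏ i, if i ∈ s u then β u.rev (trajectory x s u i) else α u.rev (trajectory x s u i)

theorem trajectoryWeight_cons {R : Type*} [CommRing R] (α β : ℕ → ℕ → R) {a n : ℕ} (x : Fin a → ℕ)
    (s₀ : Finset (Fin a)) (s : Fin n → Finset (Fin a)) :
    trajectoryWeight α β x (Fin.cons s₀ s : Fin (n + 1) → Finset (Fin a)) =
      (∏ i, if i ∈ s₀ then β n (x i) else α n (x i)) *
        trajectoryWeight α β (raise x s₀) s := by
  simp only [trajectoryWeight]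
  rw [Fin.prod_univ_succ]
  simp only [Fin.cons_zero, Fin.val_zero, trajectory_zero, Fin.cons_succ, Fin.val_succ,
    trajectory_cons, Fin.val_rev]
  congr 1
  refine Finset.prod_congr rfl fun u _ => Finset.prod_congr rfl fun i _ => ?_
  rw [Nat.add_sub_add_right]

/-- Each row is the sum of a staying and a rising term, so multilinearity in the rows gives one
determinant per set of raised particles. -/
theorem det_transfer_succ {R : Type*} [CommRing R] (α β : ℕ → ℕ → R) {a n : ℕ}
    (w : Fin a → ℕ → R) (x : Fin a → ℕ) :
    (Matrix.of fun i j => transfer α β (n + 1) (w j) (x i)).det =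
      ∑ s : Finset (Fin a), (∏ i, if i ∈ s then β n (x i) else α n (x i)) *
        (Matrix.of fun i j => transfer α β n (w j) (raise x s i)).det := by
  classical
  have h := (Matrix.detRowAlternating (n := Fin a) (R := R)).toMultilinearMap.map_add_univ
    (fun i j => β n (x i) * transfer α β n (w j) (x i + 1))
    (fun i j => α n (x i) * transfer α β n (w j) (x i))
  refine Eq.trans ?_ (h.trans (Finset.sum_congr rfl fun s _ => ?_))
  · change _ = Matrix.det _
    congr 1
    ext i j
    simp [transfer, add_comm]
  · rw [← smul_eq_mul]
    refine Eq.trans ?_ ((Matrix.detRowAlternating (n := Fin a) (R := R)).toMultilinearMap.map_smul_univ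
      (fun i => if i ∈ s then β n (x i) else α n (x i))
      (fun i j => transfer α β n (w j) (raise x s i)))
    congr 1
    ext i j
    by_cases hi : i ∈ s <;> simp [hi, raise]

/-- Particles moving by at most one cannot overtake each other; the strict order degrades at worst
to ties. -/
theorem raise_antitone {a : ℕ} {x : Fin a → ℕ} (hx : StrictAnti x) (s : Finset (Fin a)) :
    Antitone (raise x s) := by
  intro i j hij
  rcases hij.eq_or_lt with rfl | h
  · rfl
  · have := hx h
    simp only [raise]
    split_ifs <;> omega

theorem det_eq_zero_of_antitone {R : Type*} [CommRing R] {a : ℕ} {y : Fin a → ℕ}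
    (hy : Antitone y) (hy' : ¬ StrictAnti y) (f : ℕ → Fin a → R) :
    (Matrix.of fun i j => f (y i) j).det = 0 := by
  have h : ¬ Function.Injective y := fun h => hy' (hy.strictAnti_of_injective h)
  simp only [Function.Injective, not_forall] at h
  obtain ⟨i, j, hij, hne⟩ := h
  exact Matrix.det_zero_of_row_eq hne (by ext k; simp [hij])

open Classical in
/-- The determinant of a transfer matrix enumerates families of particle trajectories without
collisions. -/
theorem det_transfer {R : Type*} [CommRing R] (α β : ℕ → ℕ → R) {a : ℕ} (w : Fin a → ℕ → R)
    (n : ℕ) (x : Fin a → ℕ) (hx : StrictAnti x) :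
    (Matrix.of fun i j => transfer α β n (w j) (x i)).det =
      ∑ s : Fin n → Finset (Fin a), if ∀ t ≤ n, StrictAnti (trajectory x s t) then
        trajectoryWeight α β x s * (Matrix.of fun i j => w j (trajectory x s n i)).det else 0 := by
  induction n generalizing x with
  | zero =>
    simp [transfer, trajectoryWeight, trajectory_zero, hx]
  | succ n ih =>
    rw [det_transfer_succ, ← (Fin.consEquiv fun _ => Finset (Fin a)).sum_comp,
      Fintype.sum_prod_type]
    refine Finset.sum_congr rfl fun s₀ _ => ?_
    have key : ∀ s : Fin n → Finset (Fin a),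
        (∀ t ≤ n + 1, StrictAnti (trajectory x (Fin.cons s₀ s : Fin (n + 1) → Finset (Fin a)) t)) ↔
          ∀ t ≤ n, StrictAnti (trajectory (raise x s₀) s t) := by
      intro s
      constructor
      · intro h t ht
        rw [← trajectory_cons]
        exact h _ (by omega)
      · rintro h (_ | t) ht
        · rwa [trajectory_zero]
        · rw [trajectory_cons]
          exact h _ (by omega)
    change _ = ∑ s : Fin n → Finset (Fin a),
      if ∀ t ≤ n + 1, StrictAnti (trajectory x (Fin.cons s₀ s : Fin (n + 1) → Finset (Fin a)) t) then
        trajectoryWeight α β x (Fin.cons s₀ s : Fin (n + 1) → Finset (Fin a)) * (Matrix.of fun i j =>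
          w j (trajectory x (Fin.cons s₀ s : Fin (n + 1) → Finset (Fin a)) (n + 1) i)).det else 0
    simp only [key, trajectoryWeight_cons, trajectory_cons]
    by_cases hs : StrictAnti (raise x s₀)
    · rw [ih _ hs, Finset.mul_sum]
      refine Finset.sum_congr rfl fun s _ => ?_
      split_ifs
      · rw [mul_assoc]
      · simp
    · rw [det_eq_zero_of_antitone (raise_antitone hx s₀) hs
        (fun z j => transfer α β n (w j) z), mul_zero]
      refine (Finset.sum_eq_zero fun s _ => if_neg fun h => hs ?_).symm
      simpa [trajectory_zero] using h 0 (Nat.zero_le _)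

open Classical in
theorem det_single_of_strictAnti {R : Type*} [CommRing R] {a : ℕ} {x y : Fin a → ℕ}
    (hx : StrictAnti x) (hy : StrictAnti y) :
    (Matrix.of fun i j => (Pi.single (y j) 1 : ℕ → R) (x i)).det = if x = y then 1 else 0 := by
  split_ifs with h
  · subst h
    have : (Matrix.of fun i j => (Pi.single (x j) 1 : ℕ → R) (x i)) = 1 := by
      ext i j
      simp [Matrix.one_apply, Pi.single_apply, hx.injective.eq_iff]
    rw [this, Matrix.det_one]
  · obtain ⟨j, hj⟩ : ∃ j, ∀ i, x i ≠ y j := by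
      by_contra! hc
      choose g hg using hc
      -- If every `y j` is a value of `x`, the matching of indices is an order automorphism of `Fin
      -- a`, hence the identity.
      have hg' : StrictMono g := fun i j hij => by
        rw [← hx.lt_iff_gt, hg, hg]
        exact hy hij
      have : g = id := by
        have := Subsingleton.elim (hg'.orderIsoOfSurjective g
          (Finite.surjective_of_injective hg'.injective)) (OrderIso.refl _)
        ext i
        exact congrArg (fun e : Fin a ≃o Fin a => (e i : ℕ)) this
      apply h
      ext i
      rw [← hg i, this, id]
    exact Matrix.det_eq_zero_of_column_eq_zero j fun i => by simp [hj i]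

theorem lt_card_filter_range_iff {p : ℕ → Prop} [DecidablePred p] {c : ℕ}
    (hp : ∀ k l, k ≤ l → p l → p k) (hc : ∀ k, p k → k < c) (k : ℕ) :
    k < ((Finset.range c).filter p).card ↔ p k := by
  constructor
  · intro h
    by_contra hk
    refine absurd (Finset.card_le_card (t := Finset.range k) fun l hl => ?_) (by simpa using h)
    rw [Finset.mem_filter] at hl
    rw [Finset.mem_range]
    by_contra hlk
    exact hk (hp _ _ (not_lt.mp hlk) hl.2)
  · intro h
    refine lt_of_lt_of_le (Nat.lt_succ_self k) ?_
    calc k + 1 = (Finset.range (k + 1)).card := by simp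
      _ ≤ _ := Finset.card_le_card fun l hl => by
        have hl : p l := hp l k (by simpa [Nat.lt_succ_iff] using hl) h
        exact Finset.mem_filter.mpr ⟨Finset.mem_range.mpr (hc _ hl), hl⟩

/-! ### Plane partitions as families of lattice paths. -/

namespace PlanePartition

variable {a b c : ℕ}

/-- The cube in layer `i`, row `j`, column `k` exists and is filled. -/
def HasCube (π : PlanePartition a b c) (i : Fin a) (j k : ℕ) : Prop :=
  ∃ (hj : j < b) (hk : k < c), (i, ⟨j, hj⟩, ⟨k, hk⟩) ∈ π.1

theorem HasCube.mono {π : PlanePartition a b c} {i i' : Fin a} {j j' k k' : ℕ}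
    (h : HasCube π i j k) (hi : i' ≤ i) (hj : j' ≤ j) (hk : k' ≤ k) : HasCube π i' j' k' := by
  obtain ⟨hj', hk', h⟩ := h
  exact ⟨hj.trans_lt hj', hk.trans_lt hk', π.2 (show (i', _, _) ≤ (i, _, _) from ⟨hi, hj, hk⟩) h⟩

theorem hasCube_iff (π : PlanePartition a b c) (x : Cube a b c) :
    HasCube π x.1 x.2.1 x.2.2 ↔ x ∈ π.1 :=
  ⟨fun ⟨_, _, h⟩ => h, fun h => ⟨x.2.1.2, x.2.2.2, h⟩⟩

open Classical in
/-- The height at time `t` of the lattice path that bounds layer `i`. -/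
noncomputable def boundary (π : PlanePartition a b c) (t : ℕ) (i : Fin a) : ℕ :=
  ((Finset.range c).filter fun k => k < c ∧
    (b + k < t ∨ t ≤ b + k ∧ HasCube π i (b + k - t) k)).card

/-- The height is read off along the diagonal `k - j = t - b`. Columns `k < t - b`, where the row
would be negative, count as filled, so the filled columns form an initial segment. -/
theorem lt_boundary_iff (π : PlanePartition a b c) (t : ℕ) (i : Fin a) (k : ℕ) :
    k < boundary π t i ↔ k < c ∧ (b + k < t ∨ t ≤ b + k ∧ HasCube π i (b + k - t) k) := by
  classical
  refine lt_card_filter_range_iff ?_ (fun k h => h.1) k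
  rintro k l hkl ⟨hl, h⟩
  refine ⟨by omega, ?_⟩
  by_cases hk : b + k < t
  · exact Or.inl hk
  · rcases h with h | ⟨h, h'⟩
    · omega
    · exact Or.inr ⟨by omega, h'.mono le_rfl (by omega) hkl⟩

theorem hasCube_iff_lt_boundary (π : PlanePartition a b c) (i : Fin a) {j k : ℕ} (hj : j < b)
    (hk : k < c) : HasCube π i j k ↔ k < boundary π (b + k - j) i := by
  rw [lt_boundary_iff, show b + k - (b + k - j) = j by omega]
  constructor
  · exact fun h => ⟨hk, Or.inr ⟨by omega, h⟩⟩
  · rintro ⟨-, h | h⟩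
    · omega
    · exact h.2

theorem boundary_zero (π : PlanePartition a b c) (i : Fin a) : boundary π 0 i = 0 := by
  by_contra h
  obtain ⟨-, h | ⟨-, h, -⟩⟩ := (lt_boundary_iff π 0 i 0).mp (Nat.pos_of_ne_zero h) <;> omega

theorem boundary_le (π : PlanePartition a b c) (t : ℕ) (i : Fin a) : boundary π t i ≤ c := by
  by_contra! h
  exact absurd ((lt_boundary_iff π t i c).mp h).1 (lt_irrefl c)

theorem boundary_final (π : PlanePartition a b c) (i : Fin a) : boundary π (b + c) i = c := by
  refine le_antisymm (boundary_le π _ i) ?_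
  by_contra! h
  exact absurd ((lt_boundary_iff π (b + c) i _).mpr ⟨h, Or.inl (by omega)⟩) (lt_irrefl _)

theorem boundary_antitone (π : PlanePartition a b c) (t : ℕ) : Antitone (boundary π t) := by
  intro i i' hi
  by_contra! h
  obtain ⟨h₁, h₂⟩ := (lt_boundary_iff π t i' _).mp h
  refine absurd ((lt_boundary_iff π t i _).mpr ⟨h₁, h₂.imp_right ?_⟩) (lt_irrefl _)
  exact fun h => ⟨h.1, h.2.mono hi le_rfl le_rfl⟩

theorem boundary_le_succ (π : PlanePartition a b c) (t : ℕ) (i : Fin a) :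
    boundary π t i ≤ boundary π (t + 1) i := by
  by_contra! h
  obtain ⟨h₁, h₂⟩ := (lt_boundary_iff π t i _).mp h
  refine absurd ((lt_boundary_iff π (t + 1) i _).mpr ⟨h₁, ?_⟩) (lt_irrefl _)
  by_cases h₃ : b + boundary π (t + 1) i < t + 1
  · exact Or.inl h₃
  · rcases h₂ with h₂ | h₂
    · omega
    · exact Or.inr ⟨by omega, h₂.2.mono le_rfl (by omega) le_rfl⟩

theorem boundary_succ_le (π : PlanePartition a b c) (t : ℕ) (i : Fin a) :
    boundary π (t + 1) i ≤ boundary π t i + 1 := by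
  by_contra! h
  obtain ⟨h₁, h₂⟩ := (lt_boundary_iff π (t + 1) i _).mp h
  refine absurd ((lt_boundary_iff π t i _).mpr ⟨by omega, ?_⟩) (lt_irrefl _)
  rcases h₂ with h₂ | h₂
  · exact Or.inl (by omega)
  · exact Or.inr ⟨by omega, h₂.2.mono le_rfl (by omega) (by omega)⟩

theorem ext_boundary {π π' : PlanePartition a b c}
    (h : ∀ t ≤ b + c, boundary π t = boundary π' t) : π = π' := by
  refine Subtype.ext (Finset.ext fun x => ?_)
  rw [← hasCube_iff, ← hasCube_iff, hasCube_iff_lt_boundary _ _ x.2.1.2 x.2.2.2,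
    hasCube_iff_lt_boundary _ _ x.2.1.2 x.2.2.2, h _ (by have := x.2.2.2; omega)]

-- On diagonal `t` the filled columns form the interval from `t - b` (truncated at `0`) up to the
-- height of the path.
open Classical in
theorem card_eq_sum (π : PlanePartition a b c) :
    π.1.card = ∑ i, ∑ t ∈ Finset.range (b + c), (boundary π t i - (t - b)) := by
  rw [← Finset.sum_product', Finset.card_eq_sum_card_fiberwise
    (f := fun x : Cube a b c => (x.1, b + (x.2.2 : ℕ) - x.2.1))
    (t := Finset.univ ×ˢ Finset.range (b + c))]
  · refine Finset.sum_congr rfl ?_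
    rintro ⟨i, t⟩ -
    rw [← Nat.card_Ico]
    refine Finset.card_bij (fun x _ => (x.2.2 : ℕ)) ?_ ?_ ?_
    · rintro ⟨i', j, k⟩ hx
      simp only [Finset.mem_filter, Prod.mk.injEq] at hx
      obtain ⟨hx, rfl, rfl⟩ := hx
      rw [Finset.mem_Ico]
      exact ⟨by simp; omega,
        (hasCube_iff_lt_boundary π i' j.2 k.2).mp ((hasCube_iff π (i', j, k)).mpr hx)⟩
    · rintro ⟨i', j, k⟩ hx ⟨i'', j', k'⟩ hx' h
      simp only [Finset.mem_filter, Prod.mk.injEq] at hx hx' h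
      have := j.2
      have := j'.2
      simp only [Prod.mk.injEq, Fin.ext_iff]
      refine ⟨?_, ?_, h⟩
      · rw [hx.2.1, hx'.2.1]
      · omega
    · intro k hk
      rw [Finset.mem_Ico, lt_boundary_iff] at hk
      obtain ⟨h₁, -, h₂ | ⟨h₂, h₃, h₄, h₅⟩⟩ := hk
      · omega
      · refine ⟨_, Finset.mem_filter.mpr ⟨h₅, ?_⟩, rfl⟩
        simp only [Prod.mk.injEq, true_and]
        omega
  · intro x _
    have := x.2.2.2
    have := x.2.1.2
    simp
    omega

/-- The set of layers whose bounding path rises at time `u`. -/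
noncomputable def rises (π : PlanePartition a b c) (u : Fin (b + c)) : Finset (Fin a) :=
  Finset.univ.filter fun i => boundary π u i < boundary π (u + 1) i

theorem trajectory_rises (π : PlanePartition a b c) (x : Fin a → ℕ) {t : ℕ} (ht : t ≤ b + c)
    (i : Fin a) : trajectory x (rises π) t i = x i + boundary π t i := by
  induction t with
  | zero => rw [trajectory_zero, boundary_zero, add_zero]
  | succ t ih =>
    have := trajectory_succ x (rises π) ⟨t, ht⟩ i
    rw [this, ih (by omega)]
    have h₁ := boundary_le_succ π t i
    have h₂ := boundary_succ_le π t i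
    simp only [rises, Finset.mem_filter, Finset.mem_univ, true_and]
    split_ifs <;> omega

theorem trajectory_step_bounds {n : ℕ} (x : Fin a → ℕ) (s : Fin n → Finset (Fin a)) (i : Fin a)
    {t t' : ℕ} (h : t ≤ t') (h' : t' ≤ n) :
    trajectory x s t i ≤ trajectory x s t' i ∧
      trajectory x s t' i ≤ trajectory x s t i + (t' - t) := by
  induction t', h using Nat.le_induction with
  | base => simp
  | succ m hm ih =>
    have := trajectory_succ x s ⟨m, h'⟩ i
    have := ih (by omega)
    simp only at *
    split_ifs at * <;> omega

theorem trajectory_eq_add {n : ℕ} (x : Fin a → ℕ) (s : Fin n → Finset (Fin a)) (t : ℕ)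
    (i : Fin a) : trajectory x s t i = x i + trajectory (fun _ => 0) s t i := by
  simp [trajectory]

theorem strictAnti_rev_add {f : Fin a → ℕ} :
    StrictAnti (fun i => (i.rev : ℕ) + f i) ↔ Antitone f := by
  constructor
  · intro h
    rcases a with - | a
    · exact fun i => i.elim0
    · refine Fin.antitone_iff_succ_le.mpr fun i => ?_
      have := h (Fin.castSucc_lt_succ (i := i))
      simp only [Fin.val_rev, Fin.val_succ, Fin.val_castSucc] at this
      omega
  · intro h i j hij
    have := h hij.le
    have hij' : (i : ℕ) < j := hij
    have := j.2
    simp only [Fin.val_rev]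
    omega

/-- The plane partition whose layers are bounded by given paths. -/
def ofSteps (s : Fin (b + c) → Finset (Fin a))
    (hs : ∀ t ≤ b + c, Antitone (trajectory (fun _ => 0) s t)) : PlanePartition a b c :=
  ⟨Finset.univ.filter fun x =>
    (x.2.2 : ℕ) < trajectory (fun _ => 0) s (b + (x.2.2 : ℕ) - x.2.1) x.1, by
    rintro ⟨i, j, k⟩ ⟨i', j', k'⟩ ⟨hi, hj, hk⟩ h
    simp only [Finset.coe_filter, Finset.mem_univ, true_and, Set.mem_ofPred_eq] at h ⊢
    change i' ≤ i at hi
    change (j' : ℕ) ≤ j at hj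
    change (k' : ℕ) ≤ k at hk
    have hj2 := j.2
    have hk2 := k.2
    have h₁ := (trajectory_step_bounds (fun _ => 0) s i
      (show b + (k' : ℕ) - j ≤ b + k - j by omega) (by omega)).2
    have h₂ := (trajectory_step_bounds (fun _ => 0) s i
      (show b + (k' : ℕ) - j ≤ b + k' - j' by omega) (by omega)).1
    have h₃ := hs (b + k' - j') (by omega) hi
    omega⟩

/-- A path that ends at height `c` is at height at least `t - b` at time `t`; this matches the
convention that columns before the box count as filled. -/
theorem boundary_ofSteps (s : Fin (b + c) → Finset (Fin a))
    (hs : ∀ t ≤ b + c, Antitone (trajectory (fun _ => 0) s t))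
    (hc : ∀ i, trajectory (fun _ => 0) s (b + c) i = c) {t : ℕ} (ht : t ≤ b + c) (i : Fin a) :
    boundary (ofSteps s hs) t i = trajectory (fun _ => 0) s t i := by
  have h₁ := trajectory_step_bounds (fun _ => 0) s i (Nat.zero_le t) ht
  have h₂ := trajectory_step_bounds (fun _ => 0) s i ht le_rfl
  rw [hc] at h₂
  simp only [trajectory_zero] at h₁
  refine eq_of_forall_lt_iff fun k => ?_
  rw [lt_boundary_iff]
  have key : ∀ (hj : b + k - t < b) (hk : k < c), t ≤ b + k →
      ((i, ⟨b + k - t, hj⟩, ⟨k, hk⟩) ∈ (ofSteps s hs).1 ↔ k < trajectory (fun _ => 0) s t i) := by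
    intro hj hk htk
    simp only [ofSteps, Finset.mem_filter, Finset.mem_univ, true_and]
    rw [show b + k - (b + k - t) = t by omega]
  constructor
  · rintro ⟨hk, h | ⟨h, h₃, h₄, h₅⟩⟩
    · omega
    · exact (key h₃ h₄ h).mp h₅
  · intro h
    refine ⟨by omega, ?_⟩
    by_cases h₃ : b + k < t
    · exact Or.inl h₃
    · exact Or.inr ⟨by omega, by omega, by omega, (key _ _ (by omega)).mpr h⟩

open Classical in
/-- Plane partitions are enumerated by a determinant, with respect to step weights. -/
theorem det_transfer_eq_sum {R : Type*} [CommRing R] (α β : ℕ → ℕ → R) (a b c : ℕ) :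
    (Matrix.of fun i j : Fin a => transfer α β (b + c) (Pi.single (c + (j : ℕ)) 1) (i : ℕ)).det =
      ∑ π : PlanePartition a b c, trajectoryWeight α β (fun i => (i.rev : ℕ)) (rises π) := by
  have hx : StrictAnti fun i : Fin a => (i.rev : ℕ) := fun i j h => Fin.rev_lt_rev.mpr h
  have hy : StrictAnti fun i : Fin a => c + (i.rev : ℕ) := fun i j h =>
    Nat.add_lt_add_left (hx h) c
  -- Reversing rows and columns together makes the starting positions decrease, as `det_transfer`
  -- requires.
  rw [← Matrix.det_submatrix_equiv_self Fin.revPerm]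
  change (Matrix.of fun i j : Fin a =>
    transfer α β (b + c) (Pi.single (c + (j.rev : ℕ)) 1) (i.rev : ℕ)).det = _
  rw [det_transfer α β (fun j : Fin a => Pi.single (c + (j.rev : ℕ)) 1) (b + c)
    (fun i => (i.rev : ℕ)) hx]
  have hcond : ∀ s : Fin (b + c) → Finset (Fin a), ∀ t,
      StrictAnti (trajectory (fun i : Fin a => (i.rev : ℕ)) s t) ↔
        Antitone (trajectory (fun _ => 0) s t) := by
    intro s t
    rw [← strictAnti_rev_add]
    simp only [← trajectory_eq_add (fun i : Fin a => (i.rev : ℕ)) s t]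
  have hsum : ∀ s : Fin (b + c) → Finset (Fin a),
      (if ∀ t ≤ b + c, StrictAnti (trajectory (fun i : Fin a => (i.rev : ℕ)) s t) then
        trajectoryWeight α β (fun i : Fin a => (i.rev : ℕ)) s * (Matrix.of fun i j : Fin a =>
          (Pi.single (c + (j.rev : ℕ)) 1 : ℕ → R)
            (trajectory (fun i : Fin a => (i.rev : ℕ)) s (b + c) i)).det else 0) =
      if (∀ t ≤ b + c, Antitone (trajectory (fun _ => 0) s t)) ∧
          ∀ i, trajectory (fun _ => 0) s (b + c) i = c then
        trajectoryWeight α β (fun i : Fin a => (i.rev : ℕ)) s else 0 := by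
    intro s
    by_cases h : ∀ t ≤ b + c, StrictAnti (trajectory (fun i : Fin a => (i.rev : ℕ)) s t)
    · rw [if_pos h, det_single_of_strictAnti (h _ le_rfl) hy]
      simp only [hcond] at h
      simp only [funext_iff, trajectory_eq_add (fun i : Fin a => (i.rev : ℕ)) s (b + c),
        add_comm c, add_right_inj]
      by_cases h' : ∀ i, trajectory (fun _ => 0) s (b + c) i = c
      · rw [if_pos h', if_pos ⟨h, h'⟩, mul_one]
      · rw [if_neg h', if_neg fun h'' => h' h''.2, mul_zero]
    · rw [if_neg h]
      simp only [hcond] at h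
      rw [if_neg fun h' => h h'.1]
  rw [Finset.sum_congr rfl fun s _ => hsum s, ← Finset.sum_filter]
  symm
  refine Finset.sum_bij (fun π _ => rises π) ?_ ?_ ?_ fun _ _ => rfl
  · intro π _
    refine Finset.mem_filter.mpr ⟨Finset.mem_univ _, fun t ht => ?_, fun i => ?_⟩
    · have : trajectory (fun _ => 0) (rises π) t = boundary π t := by
        ext i
        rw [trajectory_rises π _ ht, zero_add]
      rw [this]
      exact boundary_antitone π t
    · rw [trajectory_rises π _ le_rfl, boundary_final, zero_add]
  · intro π _ π' _ h
    refine ext_boundary fun t ht => funext fun i => ?_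
    rw [← zero_add (boundary π t i), ← trajectory_rises π (fun _ => 0) ht, h,
      trajectory_rises π' (fun _ => 0) ht, zero_add]
  · intro s hs
    obtain ⟨-, hs, hc⟩ := Finset.mem_filter.mp hs
    refine ⟨ofSteps s hs, Finset.mem_univ _, ?_⟩
    ext u i
    have h := trajectory_succ (fun _ => 0) s u i
    simp only [rises, Finset.mem_filter, Finset.mem_univ, true_and]
    rw [boundary_ofSteps s hs hc u.2.le, boundary_ofSteps s hs hc u.2, h]
    split_ifs with hi <;> simp [hi]

/-- A rise at time `u` is seen at the times `u < t < n`, and there are `u.rev` of these. -/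
theorem sum_trajectory {n : ℕ} (s : Fin n → Finset (Fin a)) (i : Fin a) :
    ∑ t ∈ Finset.range n, trajectory (fun _ => 0) s t i =
      ∑ u : Fin n, if i ∈ s u then (u.rev : ℕ) else 0 := by
  simp only [trajectory, zero_add, Finset.card_filter]
  rw [Finset.sum_comm]
  refine Finset.sum_congr rfl fun u _ => ?_
  by_cases hi : i ∈ s u
  · simp only [hi, and_true, if_true]
    rw [← Finset.card_filter, Fin.val_rev, ← Nat.card_Ico]
    congr 1
    ext t
    simp
    omega
  · simp [hi]

/-- The number of cubes determines the weight in which a step that rises with `r` steps remaining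
has weight `q ^ r`. -/
theorem trajectoryWeight_pow {R : Type*} [CommRing R] (q : R) (A : ℕ → ℕ → R)
    (x : Fin a → ℕ) (π : PlanePartition a b c) :
    trajectoryWeight A (fun r z => A r z * q ^ r) x (rises π) =
      (∏ u : Fin (b + c), ∏ i, A u.rev (x i + boundary π u i)) *
        q ^ (π.1.card + a * ∑ t ∈ Finset.range (b + c), (t - b)) := by
  have hcard : π.1.card + a * ∑ t ∈ Finset.range (b + c), (t - b) =
      ∑ u : Fin (b + c), ∑ i, if i ∈ rises π u then (u.rev : ℕ) else 0 := by
    rw [Finset.sum_comm, card_eq_sum,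
      show a * ∑ t ∈ Finset.range (b + c), (t - b) =
        ∑ _i : Fin a, ∑ t ∈ Finset.range (b + c), (t - b) by simp, ← Finset.sum_add_distrib]
    refine Finset.sum_congr rfl fun i _ => ?_
    rw [← sum_trajectory, ← Finset.sum_add_distrib]
    refine Finset.sum_congr rfl fun t ht => ?_
    have ht := (Finset.mem_range.mp ht).le
    -- The path still has to reach `c`, so its height is at least `t - b` and the truncated
    -- subtraction is exact.
    have h := trajectory_step_bounds (fun _ => 0) (rises π) i ht le_rfl
    rw [trajectory_rises π _ le_rfl, trajectory_rises π _ ht, boundary_final, zero_add,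
      zero_add] at h
    rw [trajectory_rises π _ ht, zero_add]
    omega
  simp only [hcard, ← Finset.prod_pow_eq_pow_sum, ← Finset.prod_mul_distrib, trajectoryWeight]
  refine Finset.prod_congr rfl fun u _ => Finset.prod_congr rfl fun i _ => ?_
  rw [trajectory_rises π x u.2.le]
  split_ifs <;> simp

theorem trajectoryWeight_pow_one {R : Type*} [CommRing R] (q : R) (x : Fin a → ℕ)
    (π : PlanePartition a b c) :
    trajectoryWeight (fun _ _ => 1) (fun r _ => q ^ r) x (rises π) =
      q ^ (π.1.card + a * ∑ t ∈ Finset.range (b + c), (t - b)) := by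
  simpa using trajectoryWeight_pow q (fun _ _ => 1) x π

end PlanePartition

/-! ### Plane partitions at `q = -1`: splitting by parity. -/

/-- The operator `1 + s S` on functions, where `S` is the shift. -/
def addShift (s : ℤ) : (ℕ → ℤ) →ₗ[ℤ] (ℕ → ℤ) where
  toFun w z := w z + s * w (z + 1)
  map_add' v w := by ext z; simp only [Pi.add_apply]; ring
  map_smul' r w := by ext z; simp only [Pi.smul_apply, smul_eq_mul, RingHom.id_apply]; ring

/-- The operator `1 - S²`. -/
def subShiftSq : (ℕ → ℤ) →ₗ[ℤ] (ℕ → ℤ) where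
  toFun w z := w z - w (z + 2)
  map_add' v w := by ext z; simp only [Pi.add_apply]; ring
  map_smul' r w := by ext z; simp only [Pi.smul_apply, smul_eq_mul, RingHom.id_apply]; ring

theorem addShift_apply (s : ℤ) (w : ℕ → ℤ) (z : ℕ) : addShift s w z = w z + s * w (z + 1) := rfl

theorem subShiftSq_apply (w : ℕ → ℤ) (z : ℕ) : subShiftSq w z = w z - w (z + 2) := rfl

theorem transfer_one (n : ℕ) (w : ℕ → ℤ) :
    transfer (fun _ _ => 1) (fun r _ => 1 ^ r) n w = (addShift 1 ^ n) w := by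
  induction n with
  | zero => rfl
  | succ n ih =>
    ext z
    simp only [transfer, ih]
    rw [pow_succ', Module.End.mul_apply, addShift_apply, one_pow, one_mul]

theorem addShift_mul_neg : addShift 1 * addShift (-1) = subShiftSq := by
  ext1 w
  ext z
  simp only [Module.End.mul_apply, addShift_apply, subShiftSq_apply]
  ring

theorem addShift_neg_mul : addShift (-1) * addShift 1 = subShiftSq := by
  ext1 w
  ext z
  simp only [Module.End.mul_apply, addShift_apply, subShiftSq_apply]
  ring

theorem transfer_neg_one (m : ℕ) (w : ℕ → ℤ) :
    transfer (fun _ _ => 1) (fun r _ => (-1) ^ r) (2 * m) w = (subShiftSq ^ m) w ∧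
    transfer (fun _ _ => 1) (fun r _ => (-1) ^ r) (2 * m + 1) w =
      addShift 1 ((subShiftSq ^ m) w) := by
  have odd : ∀ m : ℕ,
      transfer (fun _ _ => 1) (fun r _ => (-1) ^ r) (2 * m) w = (subShiftSq ^ m) w →
      transfer (fun _ _ => 1) (fun r _ => (-1) ^ r) (2 * m + 1) w =
        addShift 1 ((subShiftSq ^ m) w) := by
    intro m h
    ext z
    simp only [transfer, h, addShift_apply, pow_mul]
    norm_num
  induction m with
  | zero => exact ⟨rfl, odd 0 rfl⟩
  | succ m ih =>
    suffices h : transfer (fun _ _ => 1) (fun r _ => (-1) ^ r) (2 * (m + 1)) w =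
        (subShiftSq ^ (m + 1)) w from ⟨h, odd _ h⟩
    have h := congrArg (fun T => T ((subShiftSq ^ m) w)) addShift_neg_mul
    simp only [Module.End.mul_apply] at h
    rw [pow_succ', Module.End.mul_apply, ← h, ← ih.2]
    ext z
    rw [show 2 * (m + 1) = 2 * m + 1 + 1 by ring, transfer]
    simp only [addShift_apply, pow_succ, pow_mul]
    norm_num

theorem numPP_eq_det (a b c : ℕ) :
    (numPP a b c : ℤ) = (Matrix.of fun i j : Fin a =>
      (addShift 1 ^ (b + c)) (Pi.single (c + (j : ℕ)) 1) (i : ℕ)).det := by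
  have h := PlanePartition.det_transfer_eq_sum (R := ℤ) (fun _ _ => 1) (fun r _ => 1 ^ r) a b c
  simp only [PlanePartition.trajectoryWeight_pow_one, transfer_one] at h
  rw [h]
  simp [numPP]

theorem sum_range_sub (b c : ℕ) : ∑ t ∈ Finset.range (b + c), (t - b) = ∑ t ∈ Finset.range c, t := by
  rw [Finset.sum_range_add, Finset.sum_eq_zero fun t ht => by
    have := Finset.mem_range.mp ht; omega, zero_add]
  simp

theorem neg_one_pow_sum_range (c : ℕ) :
    (-1 : ℤ) ^ (∑ t ∈ Finset.range (2 * c), t) = (-1) ^ c := by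
  induction c with
  | zero => rfl
  | succ c ih =>
    rw [show 2 * (c + 1) = 2 * c + 1 + 1 by ring, Finset.sum_range_succ, Finset.sum_range_succ,
      pow_add, pow_add, ih]
    simp [pow_succ, pow_mul]

/-- The sign is the fixed weight `q ^ (a * (0 + ... + (2 * c - 1)))` at `q = -1`. -/
theorem qEnumPP_neg_one_eq_det (a b c : ℕ) :
    (-1 : ℤ) ^ (a * c) * qEnumPP (-1 : ℤ) a b (2 * c) = (Matrix.of fun i j : Fin a =>
      transfer (fun _ _ => 1) (fun r _ => (-1 : ℤ) ^ r) (b + 2 * c)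
        (Pi.single (2 * c + (j : ℕ)) 1) (i : ℕ)).det := by
  rw [PlanePartition.det_transfer_eq_sum (R := ℤ)]
  simp only [PlanePartition.trajectoryWeight_pow_one, pow_add, sum_range_sub]
  rw [← Finset.sum_mul, mul_comm, qEnumPP, mul_comm a c, mul_comm a, pow_mul, pow_mul,
    neg_one_pow_sum_range]

/-- The restriction of a function to the numbers congruent to `e` modulo `2`. -/
def halve (e : ℕ) (w : ℕ → ℤ) (k : ℕ) : ℤ := w (2 * k + e)

theorem halve_subShiftSq_pow (e m : ℕ) (w : ℕ → ℤ) :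
    halve e ((subShiftSq ^ m) w) = (addShift (-1) ^ m) (halve e w) := by
  induction m with
  | zero => rfl
  | succ m ih =>
    rw [pow_succ', pow_succ', Module.End.mul_apply, Module.End.mul_apply, ← ih]
    ext k
    simp only [halve, subShiftSq_apply, addShift_apply, mul_add, add_right_comm, sub_eq_add_neg,
      mul_one, neg_one_mul]

theorem halve_single (e k : ℕ) :
    halve e (Pi.single (2 * k + e) 1) = Pi.single k 1 := by
  ext l
  simp [halve, Pi.single_apply]

theorem halve_single_eq_zero (e k : ℕ) (he : e < 2) (h : k % 2 ≠ e) :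
    halve e (Pi.single k 1) = 0 := by
  ext l
  simp only [halve, Pi.single_apply, Pi.zero_apply, ite_eq_right_iff]
  omega

theorem addShift_neg_pow (m : ℕ) (w : ℕ → ℤ) (k : ℕ) :
    (addShift (-1) ^ m) (fun l : ℕ => (-1 : ℤ) ^ l * w l) k = (-1) ^ k * (addShift 1 ^ m) w k := by
  induction m generalizing k with
  | zero => rfl
  | succ m ih =>
    simp only [pow_succ', Module.End.mul_apply, addShift_apply, ih]
    ring

theorem det_signs {n : ℕ} (M : Matrix (Fin n) (Fin n) ℤ) (c : ℕ) :
    (Matrix.of fun i j : Fin n => (-1) ^ (i : ℕ) * ((-1) ^ (c + (j : ℕ)) * M i j)).det =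
      (-1) ^ (n * c) * M.det := by
  have h₁ := Matrix.det_mul_row (fun j : Fin n => (-1 : ℤ) ^ (c + (j : ℕ))) M
  have h₂ := Matrix.det_mul_column (fun i : Fin n => (-1 : ℤ) ^ (i : ℕ))
    (Matrix.of fun i j => (-1 : ℤ) ^ (c + (j : ℕ)) * M i j)
  simp only [Matrix.of_apply] at h₂
  rw [h₂, h₁, ← mul_assoc, ← Finset.prod_mul_distrib]
  congr 1
  rw [Finset.prod_congr rfl fun (i : Fin n) _ => show (-1 : ℤ) ^ (i : ℕ) * (-1) ^ (c + (i : ℕ)) = (-1) ^ c by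
    rw [pow_add, mul_comm, mul_assoc, ← mul_pow]; simp]
  simp [← pow_mul, mul_comm]

theorem det_addShift_neg (a b c : ℕ) :
    (Matrix.of fun i j : Fin a =>
      (addShift (-1) ^ (b + c)) (Pi.single (c + (j : ℕ)) 1) (i : ℕ)).det =
      (-1) ^ (a * c) * (numPP a b c : ℤ) := by
  rw [numPP_eq_det, ← det_signs]
  congr 1
  ext i j
  have h : (Pi.single (c + (j : ℕ)) 1 : ℕ → ℤ) =
      (-1 : ℤ) ^ (c + (j : ℕ)) • fun l => (-1) ^ l * (Pi.single (c + (j : ℕ)) 1 : ℕ → ℤ) l := by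
    ext l
    by_cases hl : l = c + (j : ℕ)
    · subst hl
      simp [← mul_pow]
    · simp [hl]
  simp only [Matrix.of_apply]
  conv_lhs => rw [h]
  rw [map_smul, Pi.smul_apply, addShift_neg_pow, smul_eq_mul]
  ring

/-- The `n`-th even (`e = 0`) and odd (`e = 1`) indices below `n`. -/
def parityEquiv (n k e : ℕ) (he : e < 2) (h : ∀ i, 2 * i + e < n ↔ i < k) :
    Fin k ≃ {i : Fin n // (i : ℕ) % 2 = e} where
  toFun i := ⟨⟨2 * i + e, (h i).mpr i.2⟩, by simp; omega⟩
  invFun i := ⟨(i : ℕ) / 2, (h _).mp (by have := i.2; have := i.1.2; omega)⟩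
  left_inv i := by ext; simp; omega
  right_inv i := by have := i.2; ext; simp; omega

/-- The determinant of a matrix whose entries in odd rows and even columns vanish. -/
theorem det_eq_mul_of_parity {n k l : ℕ} (hk : n = k + l) (hl : k = l ∨ k = l + 1)
    (f : ℕ → ℕ → ℤ) (hf : ∀ i j, f (2 * i + 1) (2 * j) = 0) :
    (Matrix.of fun i j : Fin n => f i j).det =
      (Matrix.of fun i j : Fin k => f (2 * i) (2 * j)).det *
        (Matrix.of fun i j : Fin l => f (2 * i + 1) (2 * j + 1)).det := by
  rw [Matrix.twoBlockTriangular_det _ fun i : Fin n => (i : ℕ) % 2 = 0]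
  · congr 1
    · rw [← Matrix.det_submatrix_equiv_self (parityEquiv n k 0 (by omega) (by omega))]
      rfl
    · rw [← Matrix.det_submatrix_equiv_self
        ((parityEquiv n l 1 (by omega) (by omega)).trans
          (Equiv.subtypeEquivRight fun i : Fin n => by omega :
            {i : Fin n // (i : ℕ) % 2 = 1} ≃ {i : Fin n // ¬ (i : ℕ) % 2 = 0}))]
      rfl
  · intro i hi j hj
    have := hf (i / 2) (j / 2)
    rwa [show 2 * ((i : ℕ) / 2) + 1 = i by omega, show 2 * ((j : ℕ) / 2) = j by omega] at this

theorem det_eq_mul_of_parity' {n k l : ℕ} (hk : n = k + l) (hl : k = l ∨ k = l + 1)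
    (f : ℕ → ℕ → ℤ) (hf : ∀ i j, f (2 * i) (2 * j + 1) = 0) :
    (Matrix.of fun i j : Fin n => f i j).det =
      (Matrix.of fun i j : Fin k => f (2 * i) (2 * j)).det *
        (Matrix.of fun i j : Fin l => f (2 * i + 1) (2 * j + 1)).det := by
  rw [← Matrix.det_transpose, ← Matrix.det_transpose (Matrix.of fun i j : Fin k => _),
    ← Matrix.det_transpose (Matrix.of fun i j : Fin l => _)]
  exact det_eq_mul_of_parity hk hl (fun i j => f j i) fun i j => hf j i

theorem commute_addShift_subShiftSq : Commute (addShift 1) subShiftSq := by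
  rw [Commute, SemiconjBy]
  conv_lhs => rw [← addShift_neg_mul, ← mul_assoc, addShift_mul_neg]

theorem subShiftSq_entry (e k l m : ℕ) :
    (subShiftSq ^ m) (Pi.single (2 * k + e) 1) (2 * l + e) =
      (addShift (-1) ^ m) (Pi.single k 1) l := by
  rw [← halve_single e k, ← halve_subShiftSq_pow]
  rfl

theorem subShiftSq_entry_eq_zero (e k l m : ℕ) (he : e < 2) (h : k % 2 ≠ e) :
    (subShiftSq ^ m) (Pi.single k 1) (2 * l + e) = 0 := by
  have := halve_subShiftSq_pow e m (Pi.single k 1)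
  rw [halve_single_eq_zero e k he h, map_zero] at this
  exact congrFun this l

/-- All steps pair up to `1 - S²` and the column offset `2 * c` is even, so indices of different
parity do not interact. -/
theorem qEnumPP_neg_one_even {n k l : ℕ} (hn : n = k + l) (hl : k = l ∨ k = l + 1) (b c : ℕ) :
    qEnumPP (-1 : ℤ) n (2 * b) (2 * c) = (numPP k b c : ℤ) * numPP l b c := by
  have h := qEnumPP_neg_one_eq_det n (2 * b) c
  rw [← mul_add] at h
  simp only [(transfer_neg_one _ _).1] at h
  rw [det_eq_mul_of_parity hn hl fun i j =>
    (subShiftSq ^ (b + c)) (Pi.single (2 * c + j) 1) i] at h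
  · have h₀ : ∀ i j, (subShiftSq ^ (b + c)) (Pi.single (2 * c + 2 * j) 1) (2 * i) =
        (addShift (-1) ^ (b + c)) (Pi.single (c + j) 1) i := fun i j => by
      rw [← mul_add]
      exact subShiftSq_entry 0 _ _ _
    have h₁ : ∀ i j, (subShiftSq ^ (b + c)) (Pi.single (2 * c + (2 * j + 1)) 1) (2 * i + 1) =
        (addShift (-1) ^ (b + c)) (Pi.single (c + j) 1) i := fun i j => by
      rw [← add_assoc, ← mul_add]
      exact subShiftSq_entry 1 _ _ _
    simp only [h₀, h₁, det_addShift_neg] at h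
    rw [show (-1 : ℤ) ^ (k * c) * (numPP k b c : ℤ) * ((-1) ^ (l * c) * (numPP l b c : ℤ)) =
      (-1) ^ (n * c) * ((numPP k b c : ℤ) * numPP l b c) by rw [hn, add_mul, pow_add]; ring] at h
    exact mul_left_cancel₀ (pow_ne_zero _ (by norm_num)) h
  · exact fun i j => subShiftSq_entry_eq_zero 1 _ _ _ (by omega) (by omega)

/-- Adding multiples of columns without a property to columns with that property. -/
theorem det_eq_of_col_add {n : ℕ} (p : Fin n → Prop) [DecidablePred p] (σ : Fin n → Fin n)
    (hσ : ∀ j, p j → ¬ p (σ j)) (r : ℤ) (M N : Matrix (Fin n) (Fin n) ℤ)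
    (h : ∀ i j, N i j = M i j + if p j then r * M i (σ j) else 0) : N.det = M.det := by
  have hN : N = M * (1 + Matrix.of fun k j => if p j ∧ k = σ j then r else 0) := by
    ext i j
    rw [h, Matrix.mul_add, Matrix.mul_one, Matrix.add_apply, Matrix.mul_apply]
    congr 1
    by_cases hj : p j <;> simp [hj, mul_comm]
  rw [hN, Matrix.det_mul, Matrix.twoBlockTriangular_det' (1 + _) p]
  · have h₁ : ((1 + Matrix.of fun k j => if p j ∧ k = σ j then r else 0 :
        Matrix (Fin n) (Fin n) ℤ).toSquareBlockProp p) = 1 := by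
      ext ⟨i, hi⟩ ⟨j, hj⟩
      have : i ≠ σ j := fun h => hσ j hj (h ▸ hi)
      simp [Matrix.toSquareBlockProp, this, Matrix.one_apply]
    have h₂ : ((1 + Matrix.of fun k j => if p j ∧ k = σ j then r else 0 :
        Matrix (Fin n) (Fin n) ℤ).toSquareBlockProp fun i => ¬ p i) = 1 := by
      ext ⟨i, hi⟩ ⟨j, hj⟩
      simp [Matrix.toSquareBlockProp, hj, Matrix.one_apply]
    rw [h₁, h₂, Matrix.det_one, Matrix.det_one, mul_one, mul_one]
  · intro i hi j hj
    have : i ≠ j := fun h => hj (h ▸ hi)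
    simp [hj, this]

/-- A factor `1 + S` remains and mixes parities. Subtracting from each odd column its predecessor
applies `1 - S` to its basis vector, which completes another `1 - S²`; hence `b + 1` in the odd
block. These columns vanish in even rows, and in the even block only the term `1` of `1 + S`
contributes. -/
theorem qEnumPP_neg_one_odd (a b c : ℕ) :
    qEnumPP (-1 : ℤ) (2 * a + 1) (2 * b + 1) (2 * c) =
      (numPP (a + 1) b c : ℤ) * numPP a (b + 1) c := by
  have h := qEnumPP_neg_one_eq_det (2 * a + 1) (2 * b + 1) c
  rw [show 2 * b + 1 + 2 * c = 2 * (b + c) + 1 by ring] at h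
  simp only [(transfer_neg_one _ _).2] at h
  have hsingle : ∀ j, j % 2 = 1 → (Pi.single (2 * c + j) 1 + (-1 : ℤ) • Pi.single (2 * c + (j - 1)) 1 :
      ℕ → ℤ) = addShift (-1) (Pi.single (2 * c + j) 1) := by
    intro j hj
    ext z
    simp only [addShift_apply, Pi.add_apply, Pi.smul_apply, Pi.single_apply,
      show z + 1 = 2 * c + j ↔ z = 2 * c + (j - 1) by omega, smul_eq_mul]
  rw [← det_eq_of_col_add (fun j : Fin (2 * a + 1) => (j : ℕ) % 2 = 1)
    (fun j => ⟨j - 1, by omega⟩) (fun j hj => by simp only; omega) (-1) _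
    (Matrix.of fun i j : Fin (2 * a + 1) => if (j : ℕ) % 2 = 1 then
      (subShiftSq ^ (b + c + 1)) (Pi.single (2 * c + j) 1) i else
      addShift 1 ((subShiftSq ^ (b + c)) (Pi.single (2 * c + j) 1)) i) ?_] at h
  · rw [det_eq_mul_of_parity' (show 2 * a + 1 = (a + 1) + a by ring) (Or.inr rfl)
      fun i j => if j % 2 = 1 then
      (subShiftSq ^ (b + c + 1)) (Pi.single (2 * c + j) 1) i else
      addShift 1 ((subShiftSq ^ (b + c)) (Pi.single (2 * c + j) 1)) i] at h
    · have h₀ : ∀ i j, addShift 1 ((subShiftSq ^ (b + c)) (Pi.single (2 * c + 2 * j) 1)) (2 * i) =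
          (addShift (-1) ^ (b + c)) (Pi.single (c + j) 1) i := fun i j => by
        rw [addShift_apply, subShiftSq_entry_eq_zero 1 _ _ _ (by omega) (by omega), ← mul_add,
          mul_zero, add_zero]
        exact subShiftSq_entry 0 _ _ _
      have h₁ : ∀ i j, (subShiftSq ^ (b + c + 1)) (Pi.single (2 * c + (2 * j + 1)) 1) (2 * i + 1) =
          (addShift (-1) ^ (b + 1 + c)) (Pi.single (c + j) 1) i := fun i j => by
        rw [← add_assoc, ← mul_add, add_right_comm b]
        exact subShiftSq_entry 1 _ _ _
      simp only [h₀, h₁, det_addShift_neg, Nat.mul_mod_right, Nat.mul_add_mod, if_true,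
        Nat.zero_ne_one, if_false, Nat.one_mod] at h
      rw [show (-1 : ℤ) ^ ((a + 1) * c) * (numPP (a + 1) b c : ℤ) *
        ((-1) ^ (a * c) * (numPP a (b + 1) c : ℤ)) = (-1) ^ ((2 * a + 1) * c) *
          ((numPP (a + 1) b c : ℤ) * numPP a (b + 1) c) by ring] at h
      exact mul_left_cancel₀ (pow_ne_zero _ (by norm_num)) h
    · intro i j
      rw [if_pos (by omega)]
      exact subShiftSq_entry_eq_zero 0 _ _ _ (by omega) (by omega)
  · intro i j
    by_cases hj : (j : ℕ) % 2 = 1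
    · have hcomm : subShiftSq ^ (b + c + 1) =
          addShift 1 * subShiftSq ^ (b + c) * addShift (-1) := by
        rw [(commute_addShift_subShiftSq.pow_right (b + c)).eq, mul_assoc, addShift_mul_neg,
          pow_succ]
      simp only [Matrix.of_apply, if_pos hj, hcomm, Module.End.mul_apply, ← hsingle j hj, map_add,
        map_smul, Pi.add_apply, Pi.smul_apply, smul_eq_mul]
    · simp only [Matrix.of_apply, if_neg hj, add_zero]

/-! ### TCPPs: lower halves, signs and the wall. -/

namespace TCPP

variable {a b : ℕ}

theorem transposeCompl_transposeCompl {m b : ℕ} (x : Cube m b b) :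
    transposeCompl (transposeCompl x) = x := by
  simp [transposeCompl]

theorem transposeCompl_le {m b : ℕ} {x y : Cube m b b} (h : x ≤ y) :
    transposeCompl y ≤ transposeCompl x :=
  ⟨Fin.rev_le_rev.mpr h.1, Fin.rev_le_rev.mpr h.2.2, Fin.rev_le_rev.mpr h.2.1⟩

/-- The inclusion of the lower half of a box. -/
def lowerEmb (a b : ℕ) : Cube a b b ↪ Cube (2 * a) b b where
  toFun x := (⟨x.1, by omega⟩, x.2)
  inj' x y h := by
    simp only [Prod.mk.injEq, Fin.mk.injEq] at h
    exact Prod.ext (Fin.ext h.1) h.2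

theorem val_fst_lowerEmb (x : Cube a b b) : ((lowerEmb a b x).1 : ℕ) = x.1 := rfl

theorem val_fst_transposeCompl {m b : ℕ} (x : Cube m b b) :
    ((transposeCompl x).1 : ℕ) = m - (x.1 + 1) := Fin.val_rev _

theorem lowerEmb_le {x y : Cube a b b} : lowerEmb a b x ≤ lowerEmb a b y ↔ x ≤ y := Iff.rfl

theorem exists_lowerEmb {x : Cube (2 * a) b b} (h : (x.1 : ℕ) < a) : ∃ y, lowerEmb a b y = x :=
  ⟨(⟨x.1, h⟩, x.2), rfl⟩

theorem lowerEmb_or (x : Cube (2 * a) b b) :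
    (∃ y, lowerEmb a b y = x) ∨ ∃ y, transposeCompl (lowerEmb a b y) = x := by
  by_cases h : (x.1 : ℕ) < a
  · exact Or.inl (exists_lowerEmb h)
  · right
    obtain ⟨y, hy⟩ := exists_lowerEmb (x := transposeCompl x)
      (by simp only [transposeCompl, Fin.val_rev]; have := x.1.2; omega)
    exact ⟨y, by rw [hy, transposeCompl_transposeCompl]⟩

theorem lowerEmb_ne (x y : Cube a b b) : lowerEmb a b x ≠ transposeCompl (lowerEmb a b y) := by
  intro h
  have h := congrArg (fun z => (z.1 : ℕ)) h
  have := x.1.2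
  have := y.1.2
  simp only [val_fst_transposeCompl, val_fst_lowerEmb] at h
  omega

/-- The cubes of a TCPP in the lower half of the box. -/
def lowerHalf (π : TCPP (2 * a) b) : PlanePartition a b b :=
  ⟨Finset.univ.filter fun x => lowerEmb a b x ∈ π.1.1, fun x y hyx hx => by
    simp only [Finset.coe_filter, Finset.mem_univ, true_and, Set.mem_ofPred_eq] at hx ⊢
    exact π.1.2 (lowerEmb_le.mpr hyx) hx⟩

theorem mem_lowerHalf {π : TCPP (2 * a) b} {x : Cube a b b} :
    x ∈ (lowerHalf π).1 ↔ lowerEmb a b x ∈ π.1.1 := by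
  simp [lowerHalf]

/-- A plane partition that is the lower half of a TCPP. -/
def IsLowerHalf (ρ : PlanePartition a b b) : Prop :=
  ∀ x : Cube a b b, x ∈ ρ.1 ∨ (x.1, x.2.2.rev, x.2.1.rev) ∈ ρ.1

/-- If `x` is empty, its complement in the upper half is filled, and the required cube lies straight
below that one. -/
theorem isLowerHalf_lowerHalf (π : TCPP (2 * a) b) : IsLowerHalf (lowerHalf π) := by
  intro x
  rw [mem_lowerHalf, mem_lowerHalf, or_iff_not_imp_left]
  intro h
  rw [π.2, not_not] at h
  refine π.1.2 ?_ h
  refine ⟨?_, le_rfl, le_rfl⟩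
  have := x.1.2
  rw [Fin.le_def, val_fst_transposeCompl, val_fst_lowerEmb, val_fst_lowerEmb]
  omega

theorem ext_lowerHalf {π π' : TCPP (2 * a) b} (h : lowerHalf π = lowerHalf π') : π = π' := by
  have key : ∀ y, lowerEmb a b y ∈ π.1.1 ↔ lowerEmb a b y ∈ π'.1.1 := fun y => by
    rw [← mem_lowerHalf, h, mem_lowerHalf]
  refine Subtype.ext (Subtype.ext (Finset.ext fun x => ?_))
  obtain ⟨y, rfl⟩ | ⟨y, rfl⟩ := lowerEmb_or x
  · exact key y
  · rw [π.2, π'.2, transposeCompl_transposeCompl, key]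

theorem exists_lowerHalf_eq (ρ : PlanePartition a b b) (hρ : IsLowerHalf ρ) :
    ∃ π : TCPP (2 * a) b, lowerHalf π = ρ := by
  classical
  have hlow : ∀ x, (∃ y ∈ ρ.1, lowerEmb a b y = lowerEmb a b x) ↔ x ∈ ρ.1 := fun x =>
    ⟨fun ⟨y, hy, h⟩ => (lowerEmb a b).injective h ▸ hy, fun h => ⟨x, h, rfl⟩⟩
  have hup : ∀ x, (∃ y, y ∉ ρ.1 ∧ transposeCompl (lowerEmb a b y) =
      transposeCompl (lowerEmb a b x)) ↔ x ∉ ρ.1 := fun x =>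
    ⟨fun ⟨y, hy, h⟩ => (lowerEmb a b).injective
      (Function.LeftInverse.injective transposeCompl_transposeCompl h) ▸ hy, fun h => ⟨x, h, rfl⟩⟩
  let S : Finset (Cube (2 * a) b b) := Finset.univ.filter fun x =>
    (∃ y ∈ ρ.1, lowerEmb a b y = x) ∨ ∃ y, y ∉ ρ.1 ∧ transposeCompl (lowerEmb a b y) = x
  have memlow : ∀ x, lowerEmb a b x ∈ S ↔ x ∈ ρ.1 := fun x => by
    simp only [S, Finset.mem_filter, Finset.mem_univ, true_and, hlow]
    exact or_iff_left fun ⟨y, _, h⟩ => lowerEmb_ne x y h.symm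
  have memup : ∀ x, transposeCompl (lowerEmb a b x) ∈ S ↔ x ∉ ρ.1 := fun x => by
    simp only [S, Finset.mem_filter, Finset.mem_univ, true_and, hup]
    exact or_iff_right fun ⟨y, _, h⟩ => lowerEmb_ne y x h
  have hS : IsLowerSet (S : Set (Cube (2 * a) b b)) := by
    intro x y hyx hx
    rw [Finset.mem_coe] at hx ⊢
    obtain ⟨x, rfl⟩ | ⟨x, rfl⟩ := lowerEmb_or x <;> obtain ⟨y, rfl⟩ | ⟨y, rfl⟩ := lowerEmb_or y
    · rw [memlow] at hx ⊢
      exact ρ.2 (lowerEmb_le.mp hyx) hx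
    · exfalso
      have := y.1.2
      have := x.1.2
      have h : ((transposeCompl (lowerEmb a b y)).1 : ℕ) ≤ (lowerEmb a b x).1 := hyx.1
      rw [val_fst_transposeCompl, val_fst_lowerEmb, val_fst_lowerEmb] at h
      omega
    · rw [memup] at hx
      rw [memlow]
      -- In the top layer of the lower half the cube over `x` is empty too, so its reflection in
      -- that layer is filled, and this reflection dominates `y`.
      let i : Fin a := ⟨a - 1, by have := x.1.2; omega⟩
      have h : (i, x.2) ∉ ρ.1 := fun h =>
        hx (ρ.2 (show x ≤ (i, x.2) from ⟨show (x.1 : ℕ) ≤ a - 1 by omega, le_rfl⟩) h)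
      exact ρ.2 (show y ≤ (i, x.2.2.rev, x.2.1.rev) from
        ⟨show (y.1 : ℕ) ≤ a - 1 by omega, hyx.2⟩) ((hρ (i, x.2)).resolve_left h)
    · rw [memup] at hx ⊢
      have := transposeCompl_le hyx
      rw [transposeCompl_transposeCompl, transposeCompl_transposeCompl, lowerEmb_le] at this
      exact fun h => hx (ρ.2 this h)
  refine ⟨⟨⟨S, hS⟩, fun x => ?_⟩, ?_⟩
  · obtain ⟨x, rfl⟩ | ⟨x, rfl⟩ := lowerEmb_or x
    · rw [memlow, memup, not_not]
    · rw [transposeCompl_transposeCompl, memlow, memup]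
  · refine Subtype.ext (Finset.ext fun x => ?_)
    rw [mem_lowerHalf]
    exact memlow x

open Classical in
theorem sum_lowerHalf {R : Type*} [AddCommMonoid R] (f : PlanePartition a b b → R) :
    ∑ π : TCPP (2 * a) b, f (lowerHalf π) =
      ∑ ρ : PlanePartition a b b, if IsLowerHalf ρ then f ρ else 0 := by
  rw [← Finset.sum_filter]
  refine Finset.sum_bij (fun π _ => lowerHalf π) (fun π _ => ?_) (fun π _ π' _ h => ext_lowerHalf h)
    (fun ρ hρ => ?_) fun _ _ => rfl
  · exact Finset.mem_filter.mpr ⟨Finset.mem_univ _, isLowerHalf_lowerHalf π⟩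
  · obtain ⟨π, hπ⟩ := exists_lowerHalf_eq ρ (Finset.mem_filter.mp hρ).2
    exact ⟨π, Finset.mem_univ _, hπ⟩

theorem card_lowerHalf_of_move {π π' : TCPP (2 * a) b} {x : Cube (2 * a) b b} (hx : x ∈ π.1.1)
    (h : π'.1.1 = insert (transposeCompl x) (π.1.1.erase x)) :
    (lowerHalf π).1.card = (lowerHalf π').1.card + 1 ∨
      (lowerHalf π').1.card = (lowerHalf π).1.card + 1 := by
  obtain ⟨y, rfl⟩ | ⟨y, rfl⟩ := lowerEmb_or x
  · left
    have : (lowerHalf π').1 = (lowerHalf π).1.erase y := by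
      ext z
      simp [mem_lowerHalf, h, lowerEmb_ne]
    rw [this, Finset.card_erase_add_one (mem_lowerHalf.mpr hx)]
  · right
    have : (lowerHalf π').1 = insert y (lowerHalf π).1 := by
      ext z
      simp [mem_lowerHalf, h, lowerEmb_ne, transposeCompl_transposeCompl]
    rw [this, Finset.card_insert_of_notMem]
    rw [mem_lowerHalf, π.2, not_not]
    exact hx

/-- Every move adds or removes exactly one cube of the lower half. -/
theorem neg_one_pow_length {π π' : TCPP (2 * a) b} (p : (tcppMoveGraph (2 * a) b).Walk π π') :
    (-1 : ℤ) ^ p.length = (-1) ^ ((lowerHalf π).1.card + (lowerHalf π').1.card) := by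
  induction p with
  | nil => simp [← two_mul]
  | @cons u v w h p ih =>
    rw [SimpleGraph.Walk.length_cons, pow_succ, ih]
    have key : (lowerHalf u).1.card = (lowerHalf v).1.card + 1 ∨
        (lowerHalf v).1.card = (lowerHalf u).1.card + 1 := by
      obtain ⟨-, ⟨x, hx, h⟩ | ⟨x, hx, h⟩⟩ := (SimpleGraph.fromRel_adj _ _ _).mp h
      · exact card_lowerHalf_of_move hx h
      · exact (card_lowerHalf_of_move hx h).symm
    rcases key with h | h <;> rw [h] <;> ring

/-- A minimal empty cube of the lower half can be filled, since `IsLowerHalf` survives enlargement.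
Iteration connects every TCPP to the one with full lower half. -/
theorem exists_adj (π : TCPP (2 * a) b) (h : (lowerHalf π).1 ≠ Finset.univ) :
    ∃ π', (tcppMoveGraph (2 * a) b).Adj π π' ∧
      (lowerHalf π').1.card = (lowerHalf π).1.card + 1 := by
  classical
  obtain ⟨x, hx⟩ := ((lowerHalf π).1ᶜ).exists_minimal
    (by rwa [Finset.nonempty_iff_ne_empty, Ne, Finset.compl_eq_empty_iff])
  have hxn : x ∉ (lowerHalf π).1 := Finset.mem_compl.mp hx.1
  have hlower : IsLowerSet ((insert x (lowerHalf π).1 : Finset _) : Set (Cube a b b)) := by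
    intro y z hzy hy
    simp only [Finset.coe_insert, Set.mem_insert_iff, Finset.mem_coe] at hy ⊢
    rcases hy with rfl | hy
    · by_contra! hz
      exact hz.1 (le_antisymm hzy (hx.2 (Finset.mem_compl.mpr hz.2) hzy))
    · exact Or.inr ((lowerHalf π).2 hzy hy)
  obtain ⟨π', hπ'⟩ := exists_lowerHalf_eq ⟨_, hlower⟩ fun y =>
    (isLowerHalf_lowerHalf π y).imp (Finset.mem_insert_of_mem) (Finset.mem_insert_of_mem)
  have hcard : (lowerHalf π').1.card = (lowerHalf π).1.card + 1 := by
    rw [hπ', Finset.card_insert_of_notMem hxn]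
  have hmem : ∀ y, lowerEmb a b y ∈ π'.1.1 ↔ y = x ∨ lowerEmb a b y ∈ π.1.1 := fun y => by
    rw [← mem_lowerHalf, hπ', Finset.mem_insert, mem_lowerHalf]
  refine ⟨π', (SimpleGraph.fromRel_adj _ _ _).mpr ⟨?_, Or.inl
    ⟨transposeCompl (lowerEmb a b x), ?_, ?_⟩⟩, hcard⟩
  · rintro rfl
    omega
  · rwa [mem_lowerHalf, π.2, not_not] at hxn
  · ext z
    rw [transposeCompl_transposeCompl, Finset.mem_insert, Finset.mem_erase]
    obtain ⟨y, rfl⟩ | ⟨y, rfl⟩ := lowerEmb_or z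
    · rw [hmem, (lowerEmb a b).injective.eq_iff]
      simp [lowerEmb_ne]
    · rw [π'.2, transposeCompl_transposeCompl, hmem, π.2 (transposeCompl _),
        transposeCompl_transposeCompl, not_or, or_iff_right (lowerEmb_ne x y).symm, Ne,
        (Function.LeftInverse.injective transposeCompl_transposeCompl).eq_iff,
        (lowerEmb a b).injective.eq_iff]

theorem moveGraph_preconnected (a b : ℕ) : (tcppMoveGraph (2 * a) b).Preconnected := by
  classical
  have key : ∀ n (π : TCPP (2 * a) b), (lowerHalf π).1ᶜ.card = n →
      ∃ π', (lowerHalf π').1 = Finset.univ ∧ (tcppMoveGraph (2 * a) b).Reachable π π' := by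
    intro n
    induction n with
    | zero =>
      intro π h
      exact ⟨π, by rwa [Finset.card_eq_zero, Finset.compl_eq_empty_iff] at h, .refl _⟩
    | succ n ih =>
      intro π h
      obtain ⟨π', hadj, hcard⟩ := exists_adj π fun h' => by simp [h'] at h
      rw [Finset.card_compl] at h
      obtain ⟨π'', h₁, h₂⟩ := ih π' (by rw [Finset.card_compl]; omega)
      exact ⟨π'', h₁, hadj.reachable.trans h₂⟩
  intro π π'
  obtain ⟨σ, h₁, h₂⟩ := key _ π rfl
  obtain ⟨σ', h₁', h₂'⟩ := key _ π' rfl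
  obtain rfl : σ = σ' := ext_lowerHalf (Subtype.ext (h₁.trans h₁'.symm))
  exact h₂.trans h₂'.symm

theorem tcppSign_eq (π π' : TCPP (2 * a) b) :
    tcppSign π π' = (-1) ^ ((lowerHalf π).1.card + (lowerHalf π').1.card) := by
  classical
  obtain ⟨p⟩ := moveGraph_preconnected a b π π'
  rw [tcppSign]
  rcases Nat.even_or_odd p.length with h | h
  · have hp := neg_one_pow_length p
    rw [← hp, h.neg_one_pow, if_pos ⟨p, h⟩, if_neg]
    · norm_num
    · rintro ⟨p', h'⟩
      have := neg_one_pow_length p'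
      rw [← hp, h.neg_one_pow, h'.neg_one_pow] at this
      norm_num at this
  · have hp := neg_one_pow_length p
    rw [← hp, h.neg_one_pow, if_neg, if_pos ⟨p, h⟩]
    · norm_num
    · rintro ⟨p', h'⟩
      have := neg_one_pow_length p'
      rw [← hp, h.neg_one_pow, h'.neg_one_pow] at this
      norm_num at this

/-- A cube and its reflection lie on the same diagonal `u`, in columns with sum `u - 1`; one of each
such pair is filled exactly when twice the height is at least `u`. The shift `i.rev` is harmless:
heights decrease with `i`, so only the last layer, with shift `0`, binds. -/
theorem isLowerHalf_iff (ρ : PlanePartition a b b) :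
    IsLowerHalf ρ ↔ ∀ u < b + b, ∀ i : Fin a, u ≤ 2 * ((i.rev : ℕ) + ρ.boundary u i) := by
  constructor
  · intro h u hu i
    by_contra! hlt
    set k := ρ.boundary u i with hk
    have h₀ : ¬ (k < b ∧ (b + k < u ∨ u ≤ b + k ∧ ρ.HasCube i (b + k - u) k)) := fun h =>
      absurd ((ρ.lt_boundary_iff u i k).mpr h) (lt_irrefl k)
    have h₁ : u ≤ b + k := by
      by_contra! h'
      exact h₀ ⟨by omega, Or.inl h'⟩
    rcases h (i, ⟨b + k - u, by omega⟩, ⟨k, by omega⟩) with h' | h'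
    · exact h₀ ⟨by omega, Or.inr ⟨h₁, by omega, by omega, h'⟩⟩
    · rw [← ρ.hasCube_iff, ρ.hasCube_iff_lt_boundary _ (Fin.is_lt _) (Fin.is_lt _)] at h'
      simp only [Fin.val_rev] at h'
      rw [show b + (b - (b + k - u + 1)) - (b - (k + 1)) = u by omega, ← hk] at h'
      omega
  · rintro h ⟨i, j, k⟩
    have hj := j.2
    have hk := k.2
    rw [← ρ.hasCube_iff, ← ρ.hasCube_iff, ρ.hasCube_iff_lt_boundary _ (Fin.is_lt _) (Fin.is_lt _),
      ρ.hasCube_iff_lt_boundary _ (Fin.is_lt _) (Fin.is_lt _)]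
    simp only [Fin.val_rev]
    rw [show b + (b - ((j : ℕ) + 1)) - (b - (k + 1)) = b + k - j by omega]
    let l : Fin a := ⟨a - 1, by have := i.2; omega⟩
    have h₁ := h (b + k - j) (by omega) l
    have h₂ : ρ.boundary (b + k - j) l ≤ ρ.boundary (b + k - j) i :=
      ρ.boundary_antitone _ (show (i : ℕ) ≤ a - 1 by omega)
    simp only [l, Fin.val_rev] at h₁ h₂
    omega

/-- The indicator of the positions above the wall, when `r + 1` of `2 * b` steps remain. -/
def wall (b r z : ℕ) : ℤ := if 2 * b ≤ 2 * z + r + 1 then 1 else 0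

theorem det_wall_eq_sum (q : ℤ) (a b : ℕ) :
    (Matrix.of fun i j : Fin a => transfer (wall b) (fun r z => wall b r z * q ^ r) (b + b)
      (Pi.single (b + (j : ℕ)) 1) (i : ℕ)).det =
      (∑ π : TCPP (2 * a) b, q ^ (lowerHalf π).1.card) *
        q ^ (a * ∑ t ∈ Finset.range (b + b), (t - b)) := by
  rw [PlanePartition.det_transfer_eq_sum, sum_lowerHalf (fun ρ => q ^ ρ.1.card), Finset.sum_mul]
  refine Finset.sum_congr rfl fun ρ _ => ?_
  rw [PlanePartition.trajectoryWeight_pow]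
  simp only [wall, Finset.prod_boole, Finset.mem_univ, true_implies]
  have : IsLowerHalf ρ ↔ ∀ (u : Fin (b + b)) (i : Fin a),
      2 * b ≤ 2 * ((i.rev : ℕ) + ρ.boundary u i) + u.rev + 1 := by
    rw [isLowerHalf_iff]
    constructor
    · intro h u i
      have := h u u.2 i
      have := u.2
      simp only [Fin.val_rev] at *
      omega
    · intro h u hu i
      have := h ⟨u, hu⟩ i
      simp only [Fin.val_rev] at *
      omega
  by_cases h : IsLowerHalf ρ
  · rw [if_pos h, if_pos (this.mp h), one_mul, pow_add]
  · rw [if_neg h, if_neg (fun h' => h (this.mpr h')), zero_mul, zero_mul]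

theorem abs_signedTCPP (π₀ : TCPP (2 * a) b) :
    |signedTCPP π₀| = |(Matrix.of fun i j : Fin a =>
      transfer (wall b) (fun r z => wall b r z * (-1) ^ r) (b + b)
      (Pi.single (b + (j : ℕ)) 1) (i : ℕ)).det| := by
  rw [det_wall_eq_sum, abs_mul, abs_neg_one_pow, mul_one, signedTCPP]
  simp only [tcppSign_eq, pow_add]
  rw [← Finset.mul_sum, abs_mul, abs_neg_one_pow, one_mul]

theorem numTCPP_eq_det (a b : ℕ) :
    (numTCPP (2 * a) b : ℤ) = (Matrix.of fun i j : Fin a =>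
      transfer (wall b) (fun r z => wall b r z * 1 ^ r) (b + b)
      (Pi.single (b + (j : ℕ)) 1) (i : ℕ)).det := by
  rw [det_wall_eq_sum]
  simp [numTCPP]

end TCPP

/-! ### Double steps along the wall and minors of the second difference. -/

namespace TCPP

/-- Two steps at weight `1` above the wall. -/
def doubleStep : (ℕ → ℤ) →ₗ[ℤ] (ℕ → ℤ) where
  toFun w
    | 0 => w 0 + w 1
    | k + 1 => w k + 2 * w (k + 1) + w (k + 2)
  map_add' v w := by ext (_ | z) <;> simp only [Pi.add_apply] <;> ring
  map_smul' r w := by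
    ext (_ | z) <;> simp only [Pi.smul_apply, smul_eq_mul, RingHom.id_apply] <;> ring

/-- The second difference, with a reflecting boundary. -/
def secondDiff : (ℕ → ℤ) →ₗ[ℤ] (ℕ → ℤ) where
  toFun w
    | 0 => w 1 - w 0
    | k + 1 => w k - 2 * w (k + 1) + w (k + 2)
  map_add' v w := by ext (_ | z) <;> simp only [Pi.add_apply] <;> ring
  map_smul' r w := by
    ext (_ | z) <;> simp only [Pi.smul_apply, smul_eq_mul, RingHom.id_apply] <;> ring

/-- Two steps at weight `-1` above the wall. -/
def signedDoubleStep : (ℕ → ℤ) →ₗ[ℤ] (ℕ → ℤ) where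
  toFun w
    | 0 => - w 0 - w 1
    | k + 1 => w k - w (k + 2)
  map_add' v w := by ext (_ | z) <;> simp only [Pi.add_apply] <;> ring
  map_smul' r w := by
    ext (_ | z) <;> simp only [Pi.smul_apply, smul_eq_mul, RingHom.id_apply] <;> ring

theorem doubleStep_zero (w : ℕ → ℤ) : doubleStep w 0 = w 0 + w 1 := rfl
theorem doubleStep_succ (w : ℕ → ℤ) (k : ℕ) :
    doubleStep w (k + 1) = w k + 2 * w (k + 1) + w (k + 2) := rfl
theorem secondDiff_zero (w : ℕ → ℤ) : secondDiff w 0 = w 1 - w 0 := rfl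
theorem secondDiff_succ (w : ℕ → ℤ) (k : ℕ) :
    secondDiff w (k + 1) = w k - 2 * w (k + 1) + w (k + 2) := rfl
theorem signedDoubleStep_zero (w : ℕ → ℤ) : signedDoubleStep w 0 = - w 0 - w 1 := rfl
theorem signedDoubleStep_succ (w : ℕ → ℤ) (k : ℕ) :
    signedDoubleStep w (k + 1) = w k - w (k + 2) := rfl

/-- Here `k` is the distance from the wall, which climbs by one every two steps: two stays lower `k`
by one and two rises raise it by one. Only from `k = 0` does an initial stay fall below the wall, at
the intermediate time. -/
theorem transfer_wall_add_two (b m : ℕ) (hm : m < b) (q : ℤ) (w : ℕ → ℤ) (k : ℕ) :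
    transfer (wall b) (fun r z => wall b r z * q ^ r) (2 * m + 2) w (k + (b - (m + 1))) =
      (if k = 0 then 0 else transfer (wall b) (fun r z => wall b r z * q ^ r) (2 * m) w
          (k - 1 + (b - m)) +
        q ^ (2 * m) * transfer (wall b) (fun r z => wall b r z * q ^ r) (2 * m) w (k + (b - m))) +
      q ^ (2 * m + 1) * (transfer (wall b) (fun r z => wall b r z * q ^ r) (2 * m) w (k + (b - m)) +
        q ^ (2 * m) * transfer (wall b) (fun r z => wall b r z * q ^ r) (2 * m) w
          (k + 1 + (b - m))) := by
  have h₁ : wall b (2 * m + 1) (k + (b - (m + 1))) = 1 := if_pos (by omega)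
  have h₂ : wall b (2 * m) (k + (b - (m + 1)) + 1) = 1 := if_pos (by omega)
  have h₃ : wall b (2 * m) (k + (b - (m + 1))) = if k = 0 then 0 else 1 := by
    rw [wall]
    split_ifs <;> omega
  rw [show 2 * m + 2 = (2 * m + 1) + 1 by ring, transfer, transfer]
  simp only [h₁, h₂, h₃]
  rw [show k + 1 + (b - m) = k + (b - (m + 1)) + 1 + 1 by omega,
    show k + (b - m) = k + (b - (m + 1)) + 1 by omega]
  split_ifs with h
  · ring
  · rw [show k - 1 + (b - m) = k + (b - (m + 1)) by omega]
    ring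

theorem transfer_wall_one (b m : ℕ) (hm : m ≤ b) (w : ℕ → ℤ) (k : ℕ) :
    transfer (wall b) (fun r z => wall b r z * 1 ^ r) (2 * m) w (k + (b - m)) =
      (doubleStep ^ m) (fun l => w (l + b)) k := by
  induction m generalizing k with
  | zero => rfl
  | succ m ih =>
    rw [mul_add, mul_one, transfer_wall_add_two b m hm]
    simp only [ih (by omega)]
    simp only [one_pow, one_mul]
    rw [pow_succ', Module.End.mul_apply]
    rcases k with - | k
    · simp [doubleStep_zero]
    · simp only [doubleStep_succ, Nat.add_sub_cancel, Nat.succ_ne_zero, if_false]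
      ring

theorem transfer_wall_neg_one (b m : ℕ) (hm : m ≤ b) (w : ℕ → ℤ) (k : ℕ) :
    transfer (wall b) (fun r z => wall b r z * (-1) ^ r) (2 * m) w (k + (b - m)) =
      (signedDoubleStep ^ m) (fun l => w (l + b)) k := by
  induction m generalizing k with
  | zero => rfl
  | succ m ih =>
    rw [mul_add, mul_one, transfer_wall_add_two b m hm]
    simp only [ih (by omega), pow_succ (-1 : ℤ), (even_two_mul m).neg_one_pow]
    rw [pow_succ', Module.End.mul_apply]
    rcases k with - | k
    · simp [signedDoubleStep_zero]
      ring
    · simp only [signedDoubleStep_succ, Nat.add_sub_cancel, Nat.succ_ne_zero, if_false]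
      ring

theorem single_add (b j : ℕ) :
    (fun l => (Pi.single (b + j) 1 : ℕ → ℤ) (l + b)) = Pi.single j 1 := by
  ext l
  simp only [Pi.single_apply, show l + b = b + j ↔ l = j by omega]

/-- Conjugation by alternating signs turns `doubleStep` into `-secondDiff`. -/
theorem secondDiff_pow (m : ℕ) (w : ℕ → ℤ) (k : ℕ) :
    (secondDiff ^ m) (fun l : ℕ => (-1 : ℤ) ^ l * w l) k =
      (-1) ^ (m + k) * (doubleStep ^ m) w k := by
  induction m generalizing k with
  | zero => simp
  | succ m ih =>
    simp only [pow_succ' secondDiff, pow_succ' doubleStep, Module.End.mul_apply]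
    rcases k with - | k
    · rw [secondDiff_zero, doubleStep_zero, ih, ih]
      ring
    · rw [secondDiff_succ, doubleStep_succ, ih, ih, ih]
      ring

/-- The leading minor of size `n` of a power of the second difference. -/
def diffMinor (n m : ℕ) : ℤ :=
  (Matrix.of fun i j : Fin n => (secondDiff ^ m) (Pi.single (j : ℕ) 1) (i : ℕ)).det

theorem numTCPP_eq_abs_diffMinor (n m : ℕ) : (numTCPP (2 * n) m : ℤ) = |diffMinor n m| := by
  have h : diffMinor n m = (∏ i : Fin n, (-1 : ℤ) ^ (m + (i : ℕ))) *
      ((∏ j : Fin n, (-1 : ℤ) ^ (j : ℕ)) * (numTCPP (2 * n) m : ℤ)) := by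
    rw [numTCPP_eq_det, ← Matrix.det_mul_row, ← Matrix.det_mul_column, diffMinor]
    congr 1
    ext i j
    have h : (Pi.single (j : ℕ) 1 : ℕ → ℤ) =
        (-1 : ℤ) ^ (j : ℕ) • fun l => (-1) ^ l * (Pi.single (j : ℕ) 1 : ℕ → ℤ) l := by
      ext l
      by_cases hl : l = j
      · subst hl
        simp [← mul_pow]
      · simp [hl]
    have h' := transfer_wall_one m m le_rfl (Pi.single (m + (j : ℕ)) 1) i
    rw [Nat.sub_self, add_zero, single_add, two_mul] at h'
    simp only [Matrix.of_apply]
    rw [h']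
    conv_lhs => rw [h]
    rw [map_smul, Pi.smul_apply, secondDiff_pow, smul_eq_mul]
    ring
  rw [h, abs_mul, abs_mul, Finset.abs_prod, Finset.abs_prod]
  simp

theorem abs_signedTCPP_eq {n m : ℕ} (π₀ : TCPP (2 * n) m) :
    |signedTCPP π₀| = |(Matrix.of fun i j : Fin n =>
      (signedDoubleStep ^ m) (Pi.single (j : ℕ) 1) (i : ℕ)).det| := by
  rw [abs_signedTCPP]
  congr 2
  ext i j
  have h' := transfer_wall_neg_one m m le_rfl (Pi.single (m + (j : ℕ)) 1) i
  rw [Nat.sub_self, add_zero, single_add, two_mul] at h'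
  exact h'

/-- Sums of adjacent values, from an even to an odd position. -/
def pairSum (w : ℕ → ℤ) (j : ℕ) : ℤ := w (2 * j) + w (2 * j + 1)

/-- Sums of adjacent values, from an odd to an even position. -/
def pairSum' (w : ℕ → ℤ) (j : ℕ) : ℤ := w (2 * j + 1) + w (2 * j + 2)

/-- The backward difference, up to sign. -/
def backDiff (w : ℕ → ℤ) : ℕ → ℤ
  | 0 => - w 0
  | j + 1 => w j - w (j + 1)

theorem pairSum_step (w : ℕ → ℤ) : pairSum (signedDoubleStep w) = backDiff (pairSum' w) := by
  ext (_ | j)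
  · simp only [pairSum, backDiff, pairSum', mul_zero, zero_add, signedDoubleStep_zero,
      signedDoubleStep_succ w 0]
    ring
  · simp only [pairSum, backDiff, pairSum', mul_add, mul_one, signedDoubleStep_succ]
    ring

/-- The square of `signedDoubleStep` descends along `pairSum` to `secondDiff`; in particular it
preserves the kernel of `pairSum`. -/
theorem pairSum_pow_even (m : ℕ) (w : ℕ → ℤ) :
    pairSum ((signedDoubleStep ^ (2 * m)) w) = (secondDiff ^ m) (pairSum w) := by
  induction m with
  | zero => rfl
  | succ m ih =>
    rw [show 2 * (m + 1) = 2 * m + 1 + 1 by ring, pow_succ', pow_succ', pow_succ',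
      Module.End.mul_apply, Module.End.mul_apply, Module.End.mul_apply, ← ih]
    generalize (signedDoubleStep ^ (2 * m)) w = v
    rw [pairSum_step]
    ext (_ | j)
    · simp only [pairSum, backDiff, pairSum', mul_zero, zero_add, signedDoubleStep_succ v 0,
        signedDoubleStep_succ v 1, secondDiff_zero]
      ring
    · simp only [pairSum, backDiff, pairSum', mul_add, mul_one, signedDoubleStep_succ,
        secondDiff_succ]
      ring

/-- In the kernel of `pairSum` odd values are the negatives of the preceding even ones, so the even
values evolve by themselves. -/
theorem halve_pow_even (m : ℕ) (w : ℕ → ℤ) (hw : pairSum w = 0) :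
    halve 0 ((signedDoubleStep ^ (2 * m)) w) = (secondDiff ^ m) (halve 0 w) := by
  induction m with
  | zero => rfl
  | succ m ih =>
    have h : pairSum ((signedDoubleStep ^ (2 * m)) w) = 0 := by
      rw [pairSum_pow_even, hw, map_zero]
    rw [show 2 * (m + 1) = 2 * m + 1 + 1 by ring, pow_succ', pow_succ', pow_succ',
      Module.End.mul_apply, Module.End.mul_apply, Module.End.mul_apply, ← ih]
    generalize (signedDoubleStep ^ (2 * m)) w = v at h
    ext (_ | j)
    · have h₀ := congrFun h 0
      simp only [pairSum, halve, mul_zero, add_zero, zero_add, signedDoubleStep_zero,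
        signedDoubleStep_succ v 0, secondDiff_zero, Pi.zero_apply, mul_one] at h₀ ⊢
      linarith
    · simp only [halve, add_zero, mul_add, mul_one, signedDoubleStep_succ, secondDiff_succ]
      ring

theorem halve_step (w : ℕ → ℤ) (hw : pairSum' w = 0) (j : ℕ) :
    halve 0 (signedDoubleStep w) j = halve 0 w (j + 1) - halve 0 w j := by
  rcases j with - | j
  · have h := congrFun hw 0
    simp only [pairSum', halve, mul_zero, add_zero, zero_add, signedDoubleStep_zero,
      Pi.zero_apply, mul_one] at h ⊢
    linarith
  · have h₀ := congrFun hw j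
    have h₁ := congrFun hw (j + 1)
    simp only [pairSum', halve, add_zero, mul_add, mul_one, signedDoubleStep_succ,
      Pi.zero_apply] at h₀ h₁ ⊢
    linarith

/-- Adding even rows to the odd rows below them. -/
theorem det_pairSum {n : ℕ} (v : ℕ → ℕ → ℤ) :
    (Matrix.of fun i j : Fin n => v j i).det =
      (Matrix.of fun i j : Fin n =>
        if (i : ℕ) % 2 = 1 then pairSum (v j) (i / 2) else v j i).det := by
  rw [← Matrix.det_transpose, ← Matrix.det_transpose (Matrix.of fun i j : Fin n => ite _ _ _)]
  symm
  refine det_eq_of_col_add (fun j : Fin n => (j : ℕ) % 2 = 1) (fun j => ⟨j - 1, by omega⟩)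
    (fun j hj => by simp only; omega) 1 _ _ fun i j => ?_
  simp only [Matrix.transpose_apply, Matrix.of_apply, pairSum]
  split_ifs with h
  · rw [show 2 * ((j : ℕ) / 2) + 1 = j by omega, show 2 * ((j : ℕ) / 2) = j - 1 by omega]
    ring
  · simp

theorem det_eq_mul_of_pairSum {n k l : ℕ} (hk : n = k + l) (hl : k = l ∨ k = l + 1)
    (v : ℕ → ℕ → ℤ) (hv : ∀ j, pairSum (v (2 * j)) = 0) :
    (Matrix.of fun i j : Fin n => v j i).det =
      (Matrix.of fun i j : Fin k => halve 0 (v (2 * j)) i).det *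
        (Matrix.of fun i j : Fin l => pairSum (v (2 * j + 1)) i).det := by
  rw [det_pairSum, det_eq_mul_of_parity hk hl fun i j =>
    if i % 2 = 1 then pairSum (v j) (i / 2) else v j i]
  · congr 2
    · ext i j
      simp [halve]
    · ext i j
      simp only [Matrix.of_apply]
      rw [if_pos (by omega), show (2 * (i : ℕ) + 1) / 2 = i by omega]
  · intro i j
    rw [if_pos (by omega), hv]
    rfl

theorem pairSum_single_odd (l : ℕ) : pairSum (Pi.single (2 * l + 1) 1) = Pi.single l 1 := by
  ext j
  simp only [pairSum, Pi.single_apply, show 2 * j ≠ 2 * l + 1 by omega, if_false, zero_add,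
    show 2 * j + 1 = 2 * l + 1 ↔ j = l by omega]

theorem pairSum'_single_odd (l : ℕ) : pairSum' (Pi.single (2 * l + 1) 1) = Pi.single l 1 := by
  ext j
  simp only [pairSum', Pi.single_apply, show 2 * j + 2 ≠ 2 * l + 1 by omega, if_false, add_zero,
    show 2 * j + 1 = 2 * l + 1 ↔ j = l by omega]

theorem det_signedDoubleStep_even (n m : ℕ) :
    (Matrix.of fun i j : Fin (2 * n) =>
      (signedDoubleStep ^ (2 * m)) (Pi.single (j : ℕ) 1) (i : ℕ)).det = diffMinor n m ^ 2 := by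
  -- The new even basis vectors lie in the kernel of `pairSum`. As the size `2 * n` is even, every
  -- even column has a successor to subtract.
  let v : ℕ → ℕ → ℤ := fun j => if j % 2 = 0 then Pi.single j 1 - Pi.single (j + 1) 1 else
    Pi.single j 1
  have hv : ∀ l, v (2 * l) = Pi.single (2 * l) 1 - Pi.single (2 * l + 1) 1 := fun l =>
    if_pos (by omega)
  have hv' : ∀ l, v (2 * l + 1) = Pi.single (2 * l + 1) 1 := fun l => if_neg (by omega)
  have hpair : ∀ l, pairSum (v (2 * l)) = 0 := fun l => by
    ext j
    rw [hv]
    simp only [pairSum, Pi.sub_apply, Pi.single_apply, Pi.zero_apply]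
    split_ifs <;> omega
  have hhalve : ∀ l, halve 0 (v (2 * l)) = Pi.single l 1 := fun l => by
    ext j
    rw [hv]
    simp only [halve, Pi.sub_apply, Pi.single_apply]
    split_ifs <;> omega
  have h := det_eq_of_col_add (fun j : Fin (2 * n) => (j : ℕ) % 2 = 0)
    (fun j => if h : (j : ℕ) + 1 < 2 * n then ⟨j + 1, h⟩ else j)
    (fun j hj => by rw [dif_pos (by omega)]; simp only; omega) (-1)
    (Matrix.of fun i j : Fin (2 * n) =>
      (signedDoubleStep ^ (2 * m)) (Pi.single (j : ℕ) 1) (i : ℕ))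
    (Matrix.of fun i j : Fin (2 * n) => (signedDoubleStep ^ (2 * m)) (v j) (i : ℕ))
    fun i j => by
      simp only [Matrix.of_apply, v]
      by_cases hj : (j : ℕ) % 2 = 0
      · rw [if_pos hj, if_pos hj, dif_pos (by omega), map_sub, Pi.sub_apply]
        ring
      · rw [if_neg hj, if_neg hj, add_zero]
  rw [← h, det_eq_mul_of_pairSum (two_mul n) (Or.inl rfl)
    (fun j => (signedDoubleStep ^ (2 * m)) (v j))]
  · simp only [halve_pow_even m _ (hpair _), hhalve, pairSum_pow_even, hv', pairSum_single_odd]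
    rw [sq]
    rfl
  · intro j
    rw [pairSum_pow_even, hpair, map_zero]

theorem abs_neg_det {n : ℕ} (M : Matrix (Fin n) (Fin n) ℤ) : |(-M).det| = |M.det| := by
  rw [Matrix.det_neg, abs_mul, abs_neg_one_pow, one_mul]

/-- Subtracting from each column the previous one. -/
theorem det_sub_pred (n : ℕ) (v : ℕ → ℕ → ℤ) (u : ℕ → ℕ → ℤ) (h₀ : u 0 = v 0)
    (h : ∀ j, u (j + 1) = v (j + 1) - v j) :
    (Matrix.of fun i j : Fin n => u j i).det = (Matrix.of fun i j : Fin n => v j i).det := by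
  rcases n with - | n
  · simp
  · symm
    refine Matrix.det_eq_of_forall_col_eq_smul_add_pred (fun _ => 1) (fun i => ?_) fun i j => ?_
    · simp [h₀]
    · simp [h]

/-- One application of `signedDoubleStep` maps the kernel of `pairSum'` into that of `pairSum`
(`pairSum_step`); the remaining even power then acts as `secondDiff ^ m` on both blocks. -/
theorem abs_det_signedDoubleStep_odd {n k l : ℕ} (hk : n = k + l) (hl : k = l ∨ k = l + 1) (m : ℕ) :
    |(Matrix.of fun i j : Fin n =>
      (signedDoubleStep ^ (2 * m + 1)) (Pi.single (j : ℕ) 1) (i : ℕ)).det| =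
      |diffMinor k m| * |diffMinor l (m + 1)| := by
  -- The pairs of `pairSum'` begin at position `1`, so the basis vector at `0` is in its kernel
  -- unchanged.
  let v : ℕ → ℕ → ℤ := fun j => if j % 2 = 0 ∧ j ≠ 0 then Pi.single j 1 - Pi.single (j - 1) 1 else
    Pi.single j 1
  have hv' : ∀ l, v (2 * l + 1) = Pi.single (2 * l + 1) 1 := fun l => if_neg (by omega)
  have hpair : ∀ l, pairSum' (v (2 * l)) = 0 := fun l => by
    ext j
    simp only [v]
    split_ifs
    · simp only [pairSum', Pi.sub_apply, Pi.single_apply, Pi.zero_apply]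
      split_ifs <;> omega
    · simp only [pairSum', Pi.single_apply, Pi.zero_apply]
      split_ifs <;> omega
  have hhalve : ∀ l, halve 0 (v (2 * l)) = Pi.single l 1 := fun l => by
    ext j
    simp only [v]
    split_ifs
    · simp only [halve, Pi.sub_apply, Pi.single_apply]
      split_ifs <;> omega
    · simp only [halve, Pi.single_apply]
      split_ifs <;> omega
  have hzero : ∀ l, pairSum (signedDoubleStep (v (2 * l))) = 0 := fun l => by
    rw [pairSum_step, hpair]
    ext (_ | j) <;> simp [backDiff]
  have h := det_eq_of_col_add (fun j : Fin n => (j : ℕ) % 2 = 0 ∧ (j : ℕ) ≠ 0)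
    (fun j => ⟨j - 1, by omega⟩)
    (fun j hj => by simp only; omega) (-1)
    (Matrix.of fun i j : Fin n =>
      (signedDoubleStep ^ (2 * m + 1)) (Pi.single (j : ℕ) 1) (i : ℕ))
    (Matrix.of fun i j : Fin n => (signedDoubleStep ^ (2 * m + 1)) (v j) (i : ℕ))
    fun i j => by
      simp only [Matrix.of_apply, v]
      by_cases hj : (j : ℕ) % 2 = 0 ∧ (j : ℕ) ≠ 0
      · rw [if_pos hj, if_pos hj, map_sub, Pi.sub_apply]
        ring
      · rw [if_neg hj, if_neg hj, add_zero]
  rw [← h, det_eq_mul_of_pairSum hk hl (fun j => (signedDoubleStep ^ (2 * m + 1)) (v j)), abs_mul]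
  · simp only [pow_succ _ (2 * m), Module.End.mul_apply]
    simp only [halve_pow_even m _ (hzero _), pairSum_pow_even, pairSum_step, hv',
      pairSum'_single_odd]
    congr 1
    -- The forward difference sends the basis vector `e_j` to `e_(j-1) - e_j` (to `-e_0` for `j =
    -- 0`), so up to sign the columns are successive differences of those of `secondDiff ^ m`.
    · rw [diffMinor, ← det_sub_pred k (fun j => (secondDiff ^ m) (Pi.single j 1))
        (fun j => -(secondDiff ^ m) (halve 0 (signedDoubleStep (v (2 * j))))), ← abs_neg_det]
      · rfl
      · rw [← map_neg]
        congr 1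
        ext j
        rw [Pi.neg_apply, halve_step _ (hpair 0), hhalve]
        simp [Pi.single_apply]
      · intro j
        rw [← map_neg, ← map_sub]
        congr 1
        ext i
        rw [Pi.neg_apply, halve_step _ (hpair _), hhalve]
        simp only [Pi.sub_apply, Pi.single_apply]
        split_ifs <;> omega
    -- Since `backDiff` sends `e_j` to `e_(j+1) - e_j`, successive differences of its columns are
    -- those of `secondDiff`; the reflecting boundary makes the columns at `0` agree.
    · rw [diffMinor, ← det_sub_pred l (fun j => (secondDiff ^ m) (backDiff (Pi.single j 1)))
        (fun j => (secondDiff ^ (m + 1)) (Pi.single j 1))]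
      · simp only [pow_succ, Module.End.mul_apply]
        congr 1
        ext (_ | _ | j) <;> simp [backDiff, secondDiff_zero, secondDiff_succ]
      · intro j
        rw [pow_succ, Module.End.mul_apply, ← map_sub]
        congr 1
        ext (_ | i)
        · simp only [backDiff, secondDiff_zero, Pi.single_apply, Pi.sub_apply]
          split_ifs <;> omega
        · simp only [backDiff, secondDiff_succ, Pi.single_apply, Pi.sub_apply]
          split_ifs <;> omega
  · intro j
    rw [pow_succ, Module.End.mul_apply, pairSum_pow_even, hzero, map_zero]

end TCPP

theorem mainTheorem6 (a b c : ℕ) :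
    qEnumPP (-1 : ℤ) (2 * a) (2 * b) (2 * c) = (numPP a b c : ℤ) ^ 2 ∧
    qEnumPP (-1 : ℤ) (2 * a + 1) (2 * b) (2 * c) =
      (numPP a b c : ℤ) * (numPP (a + 1) b c : ℤ) ∧
    qEnumPP (-1 : ℤ) (2 * a + 1) (2 * b + 1) (2 * c) =
      (numPP a (b + 1) c : ℤ) * (numPP (a + 1) b c : ℤ) ∧
    (∀ π₀ : TCPP (4 * a) (2 * b),
      |signedTCPP π₀| = (numTCPP (2 * a) b : ℤ) ^ 2) ∧
    (∀ π₀ : TCPP (4 * a + 2) (2 * b + 1),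
      |signedTCPP π₀| = (numTCPP (2 * a) (b + 1) : ℤ) * (numTCPP (2 * a + 2) b : ℤ)) ∧
    (∀ π₀ : TCPP (4 * a) (2 * b + 1),
      |signedTCPP π₀| = (numTCPP (2 * a) b : ℤ) * (numTCPP (2 * a) (b + 1) : ℤ)) := by
  refine ⟨?_, ?_, ?_, ?_, ?_, ?_⟩
  · rw [qEnumPP_neg_one_even (two_mul a) (Or.inl rfl), sq]
  · rw [qEnumPP_neg_one_even (show 2 * a + 1 = (a + 1) + a by ring) (Or.inr rfl), mul_comm]
  · rw [qEnumPP_neg_one_odd, mul_comm]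
  · rw [show 4 * a = 2 * (2 * a) by ring]
    intro π₀
    rw [TCPP.abs_signedTCPP_eq, TCPP.det_signedDoubleStep_even, TCPP.numTCPP_eq_abs_diffMinor,
      abs_pow]
  · rw [show 4 * a + 2 = 2 * (2 * a + 1) by ring]
    intro π₀
    rw [TCPP.abs_signedTCPP_eq, TCPP.abs_det_signedDoubleStep_odd
      (show 2 * a + 1 = (a + 1) + a by ring) (Or.inr rfl), show 2 * a + 2 = 2 * (a + 1) by ring,
      TCPP.numTCPP_eq_abs_diffMinor, TCPP.numTCPP_eq_abs_diffMinor, mul_comm]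
  · rw [show 4 * a = 2 * (2 * a) by ring]
    intro π₀
    rw [TCPP.abs_signedTCPP_eq, TCPP.abs_det_signedDoubleStep_odd (two_mul a) (Or.inl rfl),
      TCPP.numTCPP_eq_abs_diffMinor, TCPP.numTCPP_eq_abs_diffMinor]
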